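/- Let $L>0$ and let $\mathcal D$ be a real distribution on $[0,L]$, that is, a continuous real-linear form on $C^\infty([0,L];\mathbb R)$, extended complex-linearly to complex-valued functions. Let $\tilde{\mathcal D}$ be the associated even distribution on $[-L,L]$, defined by $\tilde{\mathcal D}(\varphi)=\mathcal D(\varphi|_{[0,L]})+\mathcal D(\varphi(-\,\cdot)|_{[0,L]})$ for every $\varphi:[-L,L]\to\mathbb C$ that is smooth on each of $[-L,0]$ and $[0,L]$. Consider the sesquilinear form with Schwartz kernel $\tilde{\mathcal D}(x-y)$ on test functions on $[-\frac L2,\frac L2]$, $$Q(f,g)=\iint \overline{f(x)}\,\tilde{\mathcal D}(x-y)\,g(y)\,dx\,dy=\tilde{\mathcal D}\Big(t\mapsto\int_{y,\,y+t\in[-\frac L2,\frac L2]}\overline{f(y+t)}\,g(y)\,dy\Big),$$ where the space $V$ of test functions is any one of the following three: the smooth functions with compact support in $(-\frac L2,\frac L2)$; the restrictions to $[-\frac L2,\frac L2]$ of the smooth $L$-periodic functions on $\mathbb R$; all of $C^\infty([-\frac L2,\frac L2])$. Assume that $Q$ on $V$ defines a lower-bounded selfadjoint operator $A$ on the complex Hilbert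 space $L^2([-\frac L2,\frac L2])$: the form is bounded below and closable, and $A$ is the selfadjoint operator associated with its closure. Assume moreover that the minimum of the spectrum of $A$ is an isolated point of the spectrum and a simple eigenvalue, with an even eigenfunction $\eta$. Then the Fourier transform $$\widehat\eta(z)=\int_{-L/2}^{L/2}\eta(x)\,e^{-izx}\,dx,\qquad z\in\mathbb C,$$ is an entire function, and all its zeros are real. -/

import Mathlib

open MeasureTheory Set Filter Topology
open scoped ContDiff ComplexConjugate InnerProductSpace

noncomputable section

namespace RealZeros

/-! ### Real distributions on `[0, L]` and their even extension -/

/-- The space `C^∞([0, L]; ℝ)`: functions that are smooth on the closed interval, with one-sided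
derivatives at the endpoints (the values outside `[0, L]` play no role). -/
def smoothOn (L : ℝ) : Submodule ℝ (ℝ → ℝ) where
  carrier := {φ | ContDiffOn ℝ ∞ φ (Icc 0 L)}
  zero_mem' := contDiffOn_const
  add_mem' := fun h₁ h₂ => ContDiffOn.add h₁ h₂
  smul_mem' := fun c _ h => ContDiffOn.const_smul c h

/-- A real distribution on the closed interval `[0, L]`: a linear form on `C^∞([0, L]; ℝ)` that is
continuous for the Fréchet topology, i.e. bounded by finitely many of the seminorms
`φ ↦ sup_{[0, L]} |φ^(k)|`. -/
structure RealDistribution (L : ℝ) where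
  /-- the underlying linear form -/
  toLin : smoothOn L →ₗ[ℝ] ℝ
  /-- continuity -/
  bound : ∃ (N : ℕ) (C : ℝ), ∀ (φ : smoothOn L) (M : ℝ),
    (∀ k ≤ N, ∀ x ∈ Icc 0 L, |iteratedDerivWithin k (φ : ℝ → ℝ) (Icc 0 L) x| ≤ M) →
      |toLin φ| ≤ C * M

namespace RealDistribution

variable {L : ℝ}

/-- The complex-linear extension of a real distribution to complex-valued functions. -/
def pairing (D : RealDistribution L) (φ : ℝ → ℂ) (hφ : ContDiffOn ℝ ∞ φ (Icc 0 L)) : ℂ :=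
  (D.toLin ⟨fun t => (φ t).re, Complex.reCLM.contDiff.comp_contDiffOn hφ⟩ : ℂ) +
    (D.toLin ⟨fun t => (φ t).im, Complex.imCLM.contDiff.comp_contDiffOn hφ⟩ : ℂ) * Complex.I

theorem contDiffOn_comp_neg {φ : ℝ → ℂ} (h : ContDiffOn ℝ ∞ φ (Icc (-L) 0)) :
    ContDiffOn ℝ ∞ (fun t => φ (-t)) (Icc 0 L) :=
  h.comp contDiff_neg.contDiffOn fun _ ht => ⟨neg_le_neg ht.2, neg_nonpos.2 ht.1⟩

/-- The even distribution `D̃` on `[-L, L]` associated with `D`, that is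
`D̃(φ) = D(φ|_{[0, L]}) + D(φ(-·)|_{[0, L]})`. It can be evaluated on every `φ` that is smooth on
each of the closed intervals `[-L, 0]` and `[0, L]` (when `D` is a function, `D̃` is its even
extension). -/
def evenExtension (D : RealDistribution L) (φ : ℝ → ℂ)
    (hpos : ContDiffOn ℝ ∞ φ (Icc 0 L)) (hneg : ContDiffOn ℝ ∞ φ (Icc (-L) 0)) : ℂ :=
  D.pairing φ hpos + D.pairing (fun t => φ (-t)) (contDiffOn_comp_neg hneg)

end RealDistribution

/-! ### Test functions on `[-L/2, L/2]` -/

/-- Smooth complex-valued functions on the line. Only their restriction to `[-L/2, L/2]` matters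
below; these restrictions make up `C^∞([-L/2, L/2])`. -/
def smoothFunctions : Submodule ℂ (ℝ → ℂ) where
  carrier := {f | ContDiff ℝ ∞ f}
  zero_mem' := (contDiff_const : ContDiff ℝ ∞ fun _ : ℝ => (0 : ℂ))
  add_mem' := fun {f g} (h₁ : ContDiff ℝ ∞ f) (h₂ : ContDiff ℝ ∞ g) => h₁.add h₂
  smul_mem' := fun c f (h : ContDiff ℝ ∞ f) => h.const_smul c

/-- Smooth functions with compact support in the open interval `(-L/2, L/2)`. -/
def compactlySupported (L : ℝ) : Submodule ℂ smoothFunctions where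
  carrier := {f | tsupport (f : ℝ → ℂ) ⊆ Ioo (-L / 2) (L / 2)}
  zero_mem' := by simp [tsupport]
  add_mem' := fun {f g} hf hg => (tsupport_add (f : ℝ → ℂ) (g : ℝ → ℂ)).trans (union_subset hf hg)
  smul_mem' := fun c f hf =>
    (closure_mono (Function.support_const_smul_subset c (f : ℝ → ℂ))).trans hf

/-- Smooth `L`-periodic functions: the smooth span of the trigonometric orthogonal basis
`x ↦ exp (2 π i n x / L)` of `L²([-L/2, L/2])`. -/
def smoothPeriodic (L : ℝ) : Submodule ℂ smoothFunctions where
  carrier := {f | Function.Periodic (f : ℝ → ℂ) L}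
  zero_mem' := fun _ => rfl
  add_mem' := fun {_ _} hf hg => Function.Periodic.add hf hg
  smul_mem' := fun c _ hf => Function.Periodic.smul hf c

/-- Lebesgue measure on `[-L/2, L/2]`. -/
abbrev intervalMeasure (L : ℝ) : Measure ℝ := volume.restrict (Icc (-L / 2) (L / 2))

/-- The complex Hilbert space `L²([-L/2, L/2])`. -/
abbrev L2 (L : ℝ) : Type := Lp ℂ 2 (intervalMeasure L)

theorem memLp_smooth (L : ℝ) (f : smoothFunctions) : MemLp (f : ℝ → ℂ) 2 (intervalMeasure L) := by
  have hc : Continuous (f : ℝ → ℂ) := ContDiff.continuous (n := ∞) f.2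
  obtain ⟨C, hC⟩ := (isCompact_Icc (a := -L / 2) (b := L / 2)).exists_bound_of_continuousOn
    hc.continuousOn
  exact MemLp.of_bound hc.aestronglyMeasurable C
    ((ae_restrict_iff' measurableSet_Icc).2 (Eventually.of_forall hC))

/-- The class in `L²([-L/2, L/2])` of a smooth function. -/
def toL2 (L : ℝ) : smoothFunctions →ₗ[ℂ] L2 L where
  toFun f := (memLp_smooth L f).toLp _
  map_add' f g := MemLp.toLp_add (memLp_smooth L f) (memLp_smooth L g)
  map_smul' c f := MemLp.toLp_const_smul c (memLp_smooth L f)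

/-! ### The quadratic form with Schwartz kernel `D̃(x - y)` -/

/-- `correlation L f g t` is the integral of `conj (f x) * g y` over the pairs of points
`x = y + t`, `y` that both lie in `[-L/2, L/2]`. -/
def correlation (L : ℝ) (f g : ℝ → ℂ) (t : ℝ) : ℂ :=
  ∫ y in {y : ℝ | y ∈ Icc (-L / 2) (L / 2) ∧ y + t ∈ Icc (-L / 2) (L / 2)}, conj (f (y + t)) * g y

theorem contDiff_param_nat (n : ℕ) : ∀ h : ℝ → ℝ → ℂ, ContDiff ℝ ∞ (Function.uncurry h) →
    ContDiff ℝ n (fun t => ∫ s in (0 : ℝ)..1, h t s) := by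
  have key : ∀ h : ℝ → ℝ → ℂ, ContDiff ℝ ∞ (Function.uncurry h) →
      ∃ h' : ℝ → ℝ → ℂ, ContDiff ℝ ∞ (Function.uncurry h') ∧
        ∀ t, HasDerivAt (fun t => ∫ s in (0 : ℝ)..1, h t s) (∫ s in (0 : ℝ)..1, h' t s) t := by
    intro h hh
    have hd : ContDiff ℝ ∞ (fun p : ℝ × ℝ => fderiv ℝ (Function.uncurry h) p (1, 0)) :=
      (hh.fderiv_right (m := ∞) (by simp)).clm_apply contDiff_const
    refine ⟨fun t s => fderiv ℝ (Function.uncurry h) (t, s) (1, 0), hd, fun t₀ => ?_⟩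
    have hcont : Continuous (Function.uncurry h) := hh.continuous
    obtain ⟨C, hC⟩ := ((isCompact_Icc (a := t₀ - 1) (b := t₀ + 1)).prod
      (isCompact_Icc (a := (0 : ℝ)) (b := 1))).exists_bound_of_continuousOn
      hd.continuous.continuousOn
    refine (intervalIntegral.hasDerivAt_integral_of_dominated_loc_of_deriv_le
      (s := Icc (t₀ - 1) (t₀ + 1)) (bound := fun _ => C)
      (F' := fun t s => fderiv ℝ (Function.uncurry h) (t, s) (1, 0))
      (Icc_mem_nhds (by linarith) (by linarith)) ?_ ?_ ?_ ?_ ?_ ?_).2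
    · exact Eventually.of_forall fun t =>
        (hcont.comp (Continuous.prodMk_right t)).aestronglyMeasurable
    · exact (hcont.comp (Continuous.prodMk_right t₀)).intervalIntegrable _ _
    · exact (hd.continuous.comp (Continuous.prodMk_right t₀)).aestronglyMeasurable
    · refine Eventually.of_forall fun s hs t ht => hC (t, s) ⟨ht, ?_⟩
      rw [uIoc_of_le zero_le_one] at hs
      exact ⟨hs.1.le, hs.2⟩
    · exact intervalIntegrable_const
    · refine Eventually.of_forall fun s _ t _ => ?_
      have h1 : HasFDerivAt (Function.uncurry h) (fderiv ℝ (Function.uncurry h) (t, s)) (t, s) :=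
        (hh.differentiable (by simp) (t, s)).hasFDerivAt
      have h2 : HasDerivAt (fun t : ℝ => (t, s)) ((1 : ℝ), (0 : ℝ)) t :=
        (hasDerivAt_id t).prodMk (hasDerivAt_const t s)
      exact h1.comp_hasDerivAt t h2
  induction n with
  | zero =>
    intro h hh
    obtain ⟨h', -, hd⟩ := key h hh
    exact contDiff_zero.2 (continuous_iff_continuousAt.2 fun t => (hd t).continuousAt)
  | succ n ih =>
    intro h hh
    obtain ⟨h', hh', hd⟩ := key h hh
    have h3 := contDiff_succ_iff_deriv (𝕜 := ℝ) (n := (n : ℕ∞ω))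
      (f := fun t => ∫ s in (0 : ℝ)..1, h t s)
    push_cast
    refine h3.2 ⟨fun t => (hd t).differentiableAt, by simp, ?_⟩
    rw [show deriv (fun t => ∫ s in (0 : ℝ)..1, h t s) = fun t => ∫ s in (0 : ℝ)..1, h' t s from
      funext fun t => (hd t).deriv]
    exact ih h' hh'

/-- On `[0, L]` the correlation is the integral over `[-L/2, L/2 - t]`. -/
theorem correlation_of_nonneg {L t : ℝ} (f g : ℝ → ℂ) (ht : t ∈ Icc 0 L) :
    correlation L f g t = ∫ y in (-L / 2)..(L / 2 - t), conj (f (y + t)) * g y := by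
  have hset : {y : ℝ | y ∈ Icc (-L / 2) (L / 2) ∧ y + t ∈ Icc (-L / 2) (L / 2)} =
      Icc (-L / 2) (L / 2 - t) := by
    ext y
    simp only [mem_Icc, mem_ofPred_eq]
    obtain ⟨h0, h1⟩ := ht
    constructor
    · rintro ⟨⟨h2, h3⟩, h4, h5⟩
      exact ⟨h2, by linarith⟩
    · rintro ⟨h2, h3⟩
      exact ⟨⟨h2, by linarith⟩, by linarith, by linarith⟩
  rw [correlation, hset, integral_Icc_eq_integral_Ioc,
    intervalIntegral.integral_of_le (by linarith [ht.2])]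

/-- The correlation of `f` and `g` at `-t` is conjugate to the one of `g` and `f` at `t`. -/
theorem correlation_neg (L : ℝ) (f g : ℝ → ℂ) (t : ℝ) :
    correlation L f g (-t) = conj (correlation L g f t) := by
  have hm : ∀ t : ℝ, MeasurableSet
      {y : ℝ | y ∈ Icc (-L / 2) (L / 2) ∧ y + t ∈ Icc (-L / 2) (L / 2)} := fun t =>
    measurableSet_Icc.inter (measurableSet_Icc.preimage (measurable_add_const t))
  rw [correlation, correlation, ← integral_conj, ← integral_indicator (hm _),
    ← integral_indicator (hm _), ← integral_add_right_eq_self _ t]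
  congr 1
  ext y
  by_cases h : y ∈ Icc (-L / 2) (L / 2) ∧ y + t ∈ Icc (-L / 2) (L / 2)
  · rw [indicator_of_mem, indicator_of_mem]
    · simp [mul_comm]
    · exact h
    · simpa [and_comm] using h
  · rw [indicator_of_notMem, indicator_of_notMem]
    · exact h
    · simpa [and_comm] using h

theorem contDiffOn_correlation_pos (L : ℝ) (f g : smoothFunctions) :
    ContDiffOn ℝ ∞ (correlation L f g) (Icc 0 L) := by
  have hf : ContDiff ℝ ∞ (f : ℝ → ℂ) := f.2
  have hg : ContDiff ℝ ∞ (g : ℝ → ℂ) := g.2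
  have hsm : ContDiff ℝ ∞ (fun t : ℝ => (L - t) • ∫ s in (0 : ℝ)..1,
      conj ((f : ℝ → ℂ) ((L - t) * s + (-L / 2) + t)) * (g : ℝ → ℂ) ((L - t) * s + (-L / 2))) := by
    refine (contDiff_const.sub contDiff_id).smul (contDiff_infty.2 fun n =>
      contDiff_param_nat n (fun t s => conj ((f : ℝ → ℂ) ((L - t) * s + (-L / 2) + t)) *
        (g : ℝ → ℂ) ((L - t) * s + (-L / 2))) ?_)
    have ha : ContDiff ℝ ∞ (fun p : ℝ × ℝ => (L - p.1) * p.2 + (-L / 2)) := by fun_prop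
    exact (Complex.conjCLE.contDiff.comp (hf.comp (ha.add contDiff_fst))).mul (hg.comp ha)
  refine hsm.contDiffOn.congr fun t ht => ?_
  rw [correlation_of_nonneg _ _ ht]
  have := intervalIntegral.smul_integral_comp_mul_add (a := 0) (b := 1)
    (fun y => conj ((f : ℝ → ℂ) (y + t)) * (g : ℝ → ℂ) y) (L - t) (-L / 2)
  rw [this]
  congr 1 <;> ring

theorem contDiffOn_correlation_neg (L : ℝ) (f g : smoothFunctions) :
    ContDiffOn ℝ ∞ (correlation L f g) (Icc (-L) 0) := by
  have h : ContDiffOn ℝ ∞ (fun t => conj (correlation L g f (-t))) (Icc (-L) 0) :=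
    Complex.conjCLE.contDiff.comp_contDiffOn
      ((contDiffOn_correlation_pos L g f).comp contDiff_neg.contDiffOn
        fun t ht => ⟨neg_nonneg.2 ht.2, by linarith [ht.1]⟩)
  refine h.congr fun t _ => ?_
  rw [← correlation_neg, neg_neg]

/-- The sesquilinear form with Schwartz kernel `D̃(x - y)`,
`Q(f, g) = ∬ conj (f x) D̃(x - y) g(y) dx dy`, that is, `D̃` applied to the function
`t ↦ ∫ conj (f (y + t)) g(y) dy`. -/
def kernelForm {L : ℝ} (D : RealDistribution L) (f g : smoothFunctions) : ℂ :=
  D.evenExtension (correlation L f g) (contDiffOn_correlation_pos L f g)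
    (contDiffOn_correlation_neg L f g)

/-! ### The operator defined by a form, and its spectrum -/

/-- The form `Q` with domain `V` defines the operator `A` of `L²([-L/2, L/2])`: the form is bounded
below and closable, and `A` is the operator of its closure. The closure has as domain the limits in
`L²` of sequences of `V` that are Cauchy for `Q`; `u` is in the domain of `A`, with `A u = w`, when
`u` is in this form domain and the closed form satisfies `Q(v, u) = ⟪v, w⟫` for all `v` in `V`. -/
structure DefinesOperator {L : ℝ} (V : Submodule ℂ smoothFunctions)
    (Q : smoothFunctions → smoothFunctions → ℂ) (A : L2 L →ₗ.[ℂ] L2 L) : Prop where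
  lowerBounded : ∃ c : ℝ, ∀ f ∈ V, c * ‖toL2 L f‖ ^ 2 ≤ (Q f f).re
  closable : ∀ f : ℕ → smoothFunctions, (∀ n, f n ∈ V) →
    Tendsto (fun n => toL2 L (f n)) atTop (𝓝 0) →
    Tendsto (fun p : ℕ × ℕ => Q (f p.1 - f p.2) (f p.1 - f p.2)) atTop (𝓝 0) →
    Tendsto (fun n => Q (f n) (f n)) atTop (𝓝 0)
  mem_graph_iff : ∀ u w : L2 L, (u, w) ∈ A.graph ↔
    ∃ f : ℕ → smoothFunctions, (∀ n, f n ∈ V) ∧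
      Tendsto (fun n => toL2 L (f n)) atTop (𝓝 u) ∧
      Tendsto (fun p : ℕ × ℕ => Q (f p.1 - f p.2) (f p.1 - f p.2)) atTop (𝓝 0) ∧
      ∀ v ∈ V, Tendsto (fun n => Q v (f n)) atTop (𝓝 ⟪toL2 L v, w⟫_ℂ)

/-- The spectrum of an unbounded operator: the complement of the set of `z` for which `A - z` is a
bijection from the domain onto the whole space with bounded inverse. -/
def spectrum {H : Type*} [NormedAddCommGroup H] [InnerProductSpace ℂ H] (A : H →ₗ.[ℂ] H) : Set ℂ :=
  {z | ¬ ∃ R : H →L[ℂ] H, (∀ w : H, ∃ h : R w ∈ A.domain, A ⟨R w, h⟩ - z • R w = w) ∧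
    ∀ u : A.domain, R (A u - z • (u : H)) = u}

/-- The real number `l` is the minimum of the spectrum of the (selfadjoint) operator `A`, it is an
isolated point of the spectrum, and it is a simple eigenvalue with eigenvector `η`. -/
structure IsSimpleIsolatedBottom {H : Type*} [NormedAddCommGroup H] [InnerProductSpace ℂ H]
    (A : H →ₗ.[ℂ] H) (l : ℝ) (η : H) : Prop where
  mem_spectrum : (l : ℂ) ∈ spectrum A
  le_of_mem : ∀ z ∈ spectrum A, l ≤ z.re
  isolated : ∃ ε > 0, ∀ z ∈ spectrum A, ‖z - l‖ < ε → z = l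
  ne_zero : η ≠ 0
  eigenvector : ∃ h : η ∈ A.domain, A ⟨η, h⟩ = (l : ℂ) • η
  simple : ∀ u : A.domain, A u = (l : ℂ) • (u : H) → ∃ c : ℂ, (u : H) = c • η

/-- The Fourier transform `z ↦ ∫_{-L/2}^{L/2} η(x) exp (-i z x) dx`, for complex `z`. -/
def fourier {L : ℝ} (η : L2 L) (z : ℂ) : ℂ :=
  ∫ x, η x * Complex.exp (-Complex.I * z * x) ∂(intervalMeasure L)

end RealZeros

end

/-! Write `P = -i d/dx` and `η̂` for the Fourier transform of `η`. For test functions that vanish at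
both endpoints, `P` is symmetric both for `Q` and for the inner product of `L²`: these depend on
their arguments only through the correlation, and moving `P` across a correlation leaves no boundary
term.

Suppose `η̂(z) = 0` with `z` not real. On the test functions `g` with `ĝ(z) = 0`, the operator `P -
z` has an inverse `S` whose values stay in `V` and vanish at both endpoints. Let `l` be the bottom
of the spectrum and `q = Q - l⟪·, ·⟫`, so that `q ≥ 0` (`form_ge_of_spectrum`). Symmetry makes `q(S
g, g + z S g)` real, whence `|Im z| ‖S g‖_q ≤ ‖g‖_q`. As `η` is a null vector of the closure of `q`,
it is an `L²` limit of such `g n` with `‖g n‖_q → 0`. The limit `ξ` of `S (g n)` is then also a null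
vector (`exists_tendsto_mem_graph`), so `ξ = a η` by simplicity. On the Fourier side `S` divides by
`w - z` (`fourier_resolventFun`), which gives `((w - z) a - 1) η̂(w) = 0`. So `η̂` vanishes on the
real line off at most one point, and `η = 0`, a contradiction.

The bound `q ≥ 0` is read off the spectrum: below `l` the resolvent has the form `J J†`, and the
norm of a positive operator belongs to its spectrum, so this norm is at most the inverse distance to
`l`. -/

namespace RealZeros

/-! ### A closed form is bounded below by the bottom of the spectrum of its operator -/

section FormBound

open ContinuousLinearMap (adjoint)

variable {H : Type*} [NormedAddCommGroup H] [InnerProductSpace ℂ H]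

/-- The semi-inner product given by a positive hermitian form. -/
@[reducible] def formCore {E : Type*} [AddCommGroup E] [Module ℂ E]
    (q : E →ₗ⋆[ℂ] E →ₗ[ℂ] ℂ) (hq : ∀ f g, conj (q f g) = q g f) (hpos : ∀ f, 0 ≤ (q f f).re) :
    PreInnerProductSpace.Core ℂ E where
  inner f g := q f g
  conj_inner_symm f g := hq g f
  re_inner_nonneg f := hpos f
  add_left f g h := by simp
  smul_left f g c := by simp

/-- The form `Q - z ⟪j ·, j ·⟫`. -/
noncomputable def shiftedForm {E : Type*} [AddCommGroup E] [Module ℂ E] (j : E →ₗ[ℂ] H)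
    (Q : E →ₗ⋆[ℂ] E →ₗ[ℂ] ℂ) (z : ℝ) : E →ₗ⋆[ℂ] E →ₗ[ℂ] ℂ :=
  Q - (z : ℂ) • (((innerₛₗ ℂ).comp j).compl₂ j)

theorem shiftedForm_apply {E : Type*} [AddCommGroup E] [Module ℂ E] (j : E →ₗ[ℂ] H)
    (Q : E →ₗ⋆[ℂ] E →ₗ[ℂ] ℂ) (z : ℝ) (f g : E) :
    shiftedForm j Q z f g = Q f g - z * ⟪j f, j g⟫_ℂ := by
  simp [shiftedForm]

theorem re_shiftedForm_self {E : Type*} [AddCommGroup E] [Module ℂ E] (j : E →ₗ[ℂ] H)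
    (Q : E →ₗ⋆[ℂ] E →ₗ[ℂ] ℂ) (z : ℝ) (f : E) :
    (shiftedForm j Q z f f).re = (Q f f).re - z * ‖j f‖ ^ 2 := by
  rw [shiftedForm_apply, inner_self_eq_norm_sq_to_K, Complex.sub_re]
  simp only [Complex.coe_algebraMap]
  rw [Complex.re_ofReal_mul]
  norm_cast

theorem conj_shiftedForm {E : Type*} [AddCommGroup E] [Module ℂ E] (j : E →ₗ[ℂ] H)
    (Q : E →ₗ⋆[ℂ] E →ₗ[ℂ] ℂ) (hQ : ∀ f g, conj (Q f g) = Q g f) (z : ℝ) (f g : E) :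
    conj (shiftedForm j Q z f g) = shiftedForm j Q z g f := by
  rw [shiftedForm_apply, shiftedForm_apply, map_sub, hQ, map_mul, inner_conj_symm,
    Complex.conj_ofReal]

variable [CompleteSpace H]

/-- If a positive bounded operator `J J†` is the resolvent of `A` at `z`, and `l > z` is a lower
bound of the spectrum of `A`, then `‖J‖² ≤ 1 / (l - z)`. -/
theorem mul_norm_sq_le_one_of_graph {K : Type*} [NormedAddCommGroup K] [InnerProductSpace ℂ K]
    [CompleteSpace K] (J : K →L[ℂ] H) (A : H →ₗ.[ℂ] H) {z l : ℝ}
    (hg : ∀ w, (J (adjoint J w), w + (z : ℂ) • J (adjoint J w)) ∈ A.graph)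
    (hl : ∀ x ∈ spectrum A, l ≤ x.re) : (l - z) * ‖J‖ ^ 2 ≤ 1 := by
  by_contra! hlt
  set T : H →L[ℂ] H := J ∘L adjoint J with hT
  have hTn : ‖T‖ = ‖J‖ ^ 2 := by
    have := ContinuousLinearMap.norm_adjoint_comp_self (adjoint J)
    rw [ContinuousLinearMap.adjoint_adjoint] at this
    rw [hT, this, LinearIsometryEquiv.norm_map, sq]
  have hJ : 0 < ‖J‖ ^ 2 := by
    rcases (sq_nonneg ‖J‖).eq_or_lt with h | h
    · rw [← h] at hlt; norm_num at hlt
    · exact h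
  have hμ0 : 0 < ‖T‖ := hTn ▸ hJ
  have hnt : Nontrivial (H →L[ℂ] H) := ⟨⟨T, 0, fun h => by simp [h] at hμ0⟩⟩
  have hpos : 0 ≤ T := by
    rw [ContinuousLinearMap.nonneg_iff_isPositive]
    have := (ContinuousLinearMap.isPositive_adjoint_comp_self (adjoint J))
    rwa [ContinuousLinearMap.adjoint_adjoint] at this
  have hspec := CStarAlgebra.norm_mem_spectrum_of_nonneg hpos
  set μ := ‖T‖
  -- If `μ = ‖T‖` exceeded `1 / (l - z)`, the point `z + 1 / μ` would lie below `l`, hence in the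
  -- resolvent set.
  have hζ : ((z + 1 / μ : ℝ) : ℂ) ∉ spectrum A := fun h => by
    have h1 := hl _ h
    rw [Complex.ofReal_re] at h1
    rw [← hTn] at hlt
    have : (l - z) * μ ≤ 1 := (le_div_iff₀ hμ0).1 (by linarith)
    linarith
  obtain ⟨R, -, hR⟩ := not_not.1 hζ
  have hμc : (μ : ℂ) ≠ 0 := by exact_mod_cast hμ0.ne'
  -- From `(A - z) T w = w` follows `(A - z - 1/μ) T w = w - T w / μ`; then `R` is applied.
  have hRT : ∀ w, T w = R (w - (μ : ℂ)⁻¹ • T w) := fun w => by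
    obtain ⟨y, hy1, hy2⟩ := (LinearPMap.mem_graph_iff A).1 (hg w)
    have h2 := hR y
    rw [hy1, hy2] at h2
    simp only at h2
    rw [show T w = J (adjoint J w) from rfl]
    conv_lhs => rw [← h2]
    congr 1
    push_cast
    module
  -- The inverse of `μ - T` expressed through the resolvent of `A`; its existence contradicts `μ`
  -- being in the spectrum of `T`.
  set S : H →L[ℂ] H := (μ : ℂ)⁻¹ • (1 + (μ : ℂ)⁻¹ • R)
  have hS : S * (algebraMap ℝ (H →L[ℂ] H) μ - T) = 1 := by
    ext w
    have h3 := hRT w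
    have hal : (algebraMap ℝ (H →L[ℂ] H) μ) w = (μ : ℂ) • w := by
      rw [Algebra.algebraMap_eq_smul_one]
      simp
    have h4 : (μ : ℂ)⁻¹ • ((μ : ℂ) • w - T w) = w - (μ : ℂ)⁻¹ • T w := by
      rw [smul_sub, smul_smul, inv_mul_cancel₀ hμc, one_smul]
    simp only [S, mul_apply_eq_comp, sub_apply, hal,
      smul_apply, add_apply,
      one_apply_eq_self]
    rw [← map_smul, h4, ← h3, smul_add, smul_sub, smul_smul, inv_mul_cancel₀ hμc, one_smul]
    abel
  -- So far `S` is only a left inverse; since `μ - T` is selfadjoint, the adjoint of `S` is a right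
  -- inverse.
  have hsa : star (algebraMap ℝ (H →L[ℂ] H) μ - T) = algebraMap ℝ (H →L[ℂ] H) μ - T := by
    rw [star_sub, (IsSelfAdjoint.of_nonneg hpos).star_eq, ← algebraMap_star_comm]
    simp
  have hS' : (algebraMap ℝ (H →L[ℂ] H) μ - T) * star S = 1 := by
    have := congrArg star hS
    rwa [star_mul, hsa, star_one] at this
  exact hspec ⟨⟨_, S, by rwa [left_inv_eq_right_inv hS hS'], hS⟩, rfl⟩

/-- Here the inner product of `E` plays the role of `Q - z⟪·, ·⟫`. With `J` the extension of `j` to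
the completion, `J† w` solves the weak equation `⟪v, J† w⟫ = ⟪j v, w⟫`. Approximating it from `E`
shows that `J J†` satisfies the graph condition of the previous theorem. -/
theorem mul_norm_sq_le_norm_sq_of_graph {E : Type*} [SeminormedAddCommGroup E]
    [InnerProductSpace ℂ E] (j : E →L[ℂ] H) (A : H →ₗ.[ℂ] H) {z l : ℝ} (hzl : z < l)
    (hg : ∀ (u w : H) (f : ℕ → E), CauchySeq f → Tendsto (fun n => j (f n)) atTop (𝓝 u) →
      (∀ v, Tendsto (fun n => ⟪v, f n⟫_ℂ) atTop (𝓝 ⟪j v, w⟫_ℂ)) → (u, w + (z : ℂ) • u) ∈ A.graph)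
    (hl : ∀ x ∈ spectrum A, l ≤ x.re) (f : E) : (l - z) * ‖j f‖ ^ 2 ≤ ‖f‖ ^ 2 := by
  set e : E →L[ℂ] UniformSpace.Completion E := UniformSpace.Completion.toComplL with he
  have hed : DenseRange e := UniformSpace.Completion.denseRange_coe
  have heu : IsUniformInducing e := UniformSpace.Completion.isUniformInducing_coe E
  set J : UniformSpace.Completion E →L[ℂ] H := j.extend e
  have hJ : ∀ x, J (e x) = j x := fun x => ContinuousLinearMap.extend_eq j hed heu x
  have hgr : ∀ w, (J (adjoint J w), w + (z : ℂ) • J (adjoint J w)) ∈ A.graph := fun w => by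
    obtain ⟨s, hs, hlim⟩ := mem_closure_iff_seq_limit.1 (hed (adjoint J w))
    choose g hgs using hs
    have hlim' : Tendsto (fun n => e (g n)) atTop (𝓝 (adjoint J w)) := by simpa only [hgs] using hlim
    refine hg _ w g ?_ ?_ fun v => ?_
    · exact heu.cauchy_map_iff.1 (by rw [map_map]; exact hlim'.cauchySeq)
    · simpa only [hJ, Function.comp_def] using (J.continuous.tendsto _).comp hlim'
    · have h1 : Tendsto (fun n => ⟪e v, e (g n)⟫_ℂ) atTop (𝓝 ⟪e v, adjoint J w⟫_ℂ) :=
        tendsto_const_nhds.inner hlim'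
      rw [ContinuousLinearMap.adjoint_inner_right, hJ] at h1
      exact h1.congr fun n => UniformSpace.Completion.inner_coe _ _
  have hb := mul_norm_sq_le_one_of_graph J A hgr hl
  have h1 : ‖j f‖ ≤ ‖J‖ * ‖f‖ := by
    rw [← hJ, ← UniformSpace.Completion.norm_coe f]
    exact J.le_opNorm _
  calc (l - z) * ‖j f‖ ^ 2 ≤ (l - z) * (‖J‖ * ‖f‖) ^ 2 := by
        have : 0 ≤ l - z := by linarith
        gcongr
    _ = ((l - z) * ‖J‖ ^ 2) * ‖f‖ ^ 2 := by ring
    _ ≤ 1 * ‖f‖ ^ 2 := by gcongr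
    _ = _ := one_mul _

/-- A hermitian form is bounded below by any real lower bound of the spectrum of the operator that
it defines. -/
theorem form_ge_of_spectrum {E : Type*} [AddCommGroup E] [Module ℂ E] (j : E →ₗ[ℂ] H)
    (Q : E →ₗ⋆[ℂ] E →ₗ[ℂ] ℂ) (hQ : ∀ f g, conj (Q f g) = Q g f) {c : ℝ}
    (hc : ∀ f, c * ‖j f‖ ^ 2 ≤ (Q f f).re) (A : H →ₗ.[ℂ] H)
    (hg : ∀ (u w : H) (f : ℕ → E), Tendsto (fun n => j (f n)) atTop (𝓝 u) →
      Tendsto (fun p : ℕ × ℕ => Q (f p.1 - f p.2) (f p.1 - f p.2)) atTop (𝓝 0) →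
      (∀ v, Tendsto (fun n => Q v (f n)) atTop (𝓝 ⟪j v, w⟫_ℂ)) → (u, w) ∈ A.graph)
    {l : ℝ} (hl : ∀ x ∈ spectrum A, l ≤ x.re) (f : E) : l * ‖j f‖ ^ 2 ≤ (Q f f).re := by
  -- One unit below `c`, so that the shifted form dominates `‖j ·‖ ^ 2` and `j` is a contraction;
  -- strictly below `l`, as the spectral argument requires.
  set z : ℝ := min c l - 1 with hz
  have hzc : z + 1 ≤ c := by rw [hz]; linarith [min_le_left c l]
  have hzl : z < l := by rw [hz]; linarith [min_le_right c l]
  set q : E →ₗ⋆[ℂ] E →ₗ[ℂ] ℂ := shiftedForm j Q z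
  have hqa : ∀ f g, q f g = Q f g - z * ⟪j f, j g⟫_ℂ := shiftedForm_apply j Q z
  have hself : ∀ f, (q f f).re = (Q f f).re - z * ‖j f‖ ^ 2 := re_shiftedForm_self j Q z
  have hge : ∀ f, ‖j f‖ ^ 2 ≤ (q f f).re := fun f => by
    rw [hself]
    nlinarith [hc f, sq_nonneg ‖j f‖]
  let core : PreInnerProductSpace.Core ℂ E := formCore q (conj_shiftedForm j Q hQ z)
    fun f => (sq_nonneg _).trans (hge f)
  let : SeminormedAddCommGroup E :=
    InnerProductSpace.Core.toSeminormedAddCommGroup (𝕜 := ℂ) (c := core)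
  let : InnerProductSpace ℂ E := InnerProductSpace.ofCore core
  have hinner : ∀ f g : E, ⟪f, g⟫_ℂ = q f g := fun _ _ => rfl
  have hnorm : ∀ f : E, ‖f‖ ^ 2 = (q f f).re := fun f => by
    rw [← hinner]
    exact norm_sq_eq_re_inner (𝕜 := ℂ) f
  have hj : ∀ f : E, ‖j f‖ ≤ 1 * ‖f‖ := fun f => by
    rw [one_mul]
    exact le_of_sq_le_sq (by rw [hnorm]; exact hge f) (norm_nonneg _)
  have key := mul_norm_sq_le_norm_sq_of_graph (j.mkContinuous 1 hj) A hzl ?_ hl f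
  · rw [hnorm, hself, LinearMap.mkContinuous_apply] at key
    linarith
  · intro u w f hf hu hv
    simp only [LinearMap.mkContinuous_apply] at hu hv
    refine hg _ _ f hu ?_ fun v => ?_
    · have h1 : Tendsto (fun p : ℕ × ℕ => ‖f p.1 - f p.2‖) atTop (𝓝 0) := by
        have := cauchySeq_iff_tendsto_dist_atTop_0.1 hf
        simpa only [dist_eq_norm] using this
      have h2 : ∀ x : E, ‖Q x x‖ ≤ ‖x‖ ^ 2 + |z| * ‖x‖ ^ 2 := fun x => by
        have h3 : Q x x = q x x + z * ⟪j x, j x⟫_ℂ := by rw [hqa]; ring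
        have h4 := hj x
        rw [one_mul] at h4
        rw [h3]
        refine (norm_add_le _ _).trans ?_
        rw [← hinner, inner_self_eq_norm_sq_to_K, inner_self_eq_norm_sq_to_K, norm_mul]
        simp only [norm_pow, Complex.norm_real, Real.norm_eq_abs, abs_norm, RCLike.ofReal_eq_complex_ofReal]
        gcongr
      refine squeeze_zero_norm (fun p => h2 _) ?_
      simpa using ((h1.pow 2).add ((h1.pow 2).const_mul |z|))
    · have h1 := (hv v).add ((tendsto_const_nhds.inner hu).const_mul (z : ℂ) :
        Tendsto (fun n => (z : ℂ) * ⟪j v, j (f n)⟫_ℂ) atTop (𝓝 ((z : ℂ) * ⟪j v, u⟫_ℂ)))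
      rw [inner_add_right, inner_smul_right]
      refine h1.congr fun n => ?_
      rw [hinner, hqa]
      ring

end FormBound

/-! ### Eigenvectors at the bottom of a form and a symmetric first order operator -/

section Eigenvector

/-- The limit in the completion is orthogonal to a dense subspace, hence zero. -/
theorem tendsto_norm_zero_of_cauchySeq_of_inner {E : Type*} [SeminormedAddCommGroup E]
    [InnerProductSpace ℂ E] {f : ℕ → E} (hf : CauchySeq f)
    (h : ∀ v, Tendsto (fun n => ⟪v, f n⟫_ℂ) atTop (𝓝 0)) :
    Tendsto (fun n => ‖f n‖) atTop (𝓝 0) := by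
  have hc : CauchySeq fun n => (f n : UniformSpace.Completion E) :=
    (UniformSpace.Completion.uniformContinuous_coe E).comp_cauchySeq hf
  obtain ⟨F, hF⟩ := cauchySeq_tendsto_of_complete hc
  have hF0 : F = 0 := by
    refine (UniformSpace.Completion.denseRange_coe (α := E)).eq_zero_of_inner_right ℂ fun v => ?_
    have h1 : Tendsto (fun n => ⟪(v : UniformSpace.Completion E),
        (f n : UniformSpace.Completion E)⟫_ℂ) atTop (𝓝 ⟪(v : UniformSpace.Completion E), F⟫_ℂ) :=
      tendsto_const_nhds.inner hF
    simp only [UniformSpace.Completion.inner_coe] at h1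
    exact tendsto_nhds_unique h1 (h v)
  rw [hF0] at hF
  simpa [Function.comp_def] using hF.norm

/-- If `⟪x, g + z x⟫` is real, then `|Im z| ‖x‖ ≤ ‖g‖`. -/
theorem abs_im_mul_norm_le_of_im_inner_eq_zero {E : Type*} [SeminormedAddCommGroup E]
    [InnerProductSpace ℂ E] {x g : E} {z : ℂ} (h : (⟪x, g + z • x⟫_ℂ).im = 0) :
    |z.im| * ‖x‖ ≤ ‖g‖ := by
  rw [inner_add_right, inner_smul_right, inner_self_eq_norm_sq_to_K, Complex.add_im] at h
  have h1 : (z * ((‖x‖ : ℂ)) ^ 2).im = z.im * ‖x‖ ^ 2 := by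
    rw [← Complex.ofReal_pow, Complex.im_mul_ofReal]
  have h2 : |z.im| * ‖x‖ ^ 2 ≤ ‖x‖ * ‖g‖ := by
    rw [show |z.im| * ‖x‖ ^ 2 = |z.im * ‖x‖ ^ 2| by rw [abs_mul, abs_of_nonneg (sq_nonneg ‖x‖)]]
    have h3 : z.im * ‖x‖ ^ 2 = - (⟪x, g⟫_ℂ).im := by
      rw [← h1]
      exact (neg_eq_of_add_eq_zero_right h).symm
    rw [h3, abs_neg]
    exact (Complex.abs_im_le_norm _).trans (norm_inner_le_norm x g)
  rcases (norm_nonneg x).eq_or_lt with hx | hx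
  · rw [← hx, mul_zero]
    exact norm_nonneg g
  · refine le_of_mul_le_mul_left ?_ hx
    linarith [h2]

variable {H : Type*} [NormedAddCommGroup H] [InnerProductSpace ℂ H]

/-- Let `l` be a lower bound of a hermitian form and an eigenvalue, with eigenvector `η` orthogonal
to `e`. If `S` inverts, on the orthogonal of `e`, an operator `P - z` with `P` symmetric for
the form and for the inner product and `z` not real, then `S η` belongs to the eigenspace. -/
theorem exists_tendsto_mem_graph {E : Type*} [AddCommGroup E] [Module ℂ E] (j : E →ₗ[ℂ] H)
    (Q : E →ₗ⋆[ℂ] E →ₗ[ℂ] ℂ) (hQ : ∀ f g, conj (Q f g) = Q g f) {l : ℝ}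
    (hl : ∀ f, l * ‖j f‖ ^ 2 ≤ (Q f f).re) (A : H →ₗ.[ℂ] H)
    (hA : ∀ u w : H, (u, w) ∈ A.graph ↔ ∃ f : ℕ → E, Tendsto (fun n => j (f n)) atTop (𝓝 u) ∧
      Tendsto (fun p : ℕ × ℕ => Q (f p.1 - f p.2) (f p.1 - f p.2)) atTop (𝓝 0) ∧
      ∀ v, Tendsto (fun n => Q v (f n)) atTop (𝓝 ⟪j v, w⟫_ℂ))
    [CompleteSpace H] {η : H} (hη : (η, (l : ℂ) • η) ∈ A.graph) {e : H} {χ : E}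
    (hχ : ⟪e, j χ⟫_ℂ = 1) (heη : ⟪e, η⟫_ℂ = 0) {z : ℂ} (hz : z.im ≠ 0) (S : E → E) (C : ℝ)
    (hSC : ∀ f g, ⟪e, j f⟫_ℂ = 0 → ⟪e, j g⟫_ℂ = 0 → ‖j (S f) - j (S g)‖ ≤ C * ‖j f - j g‖)
    (hSQ : ∀ g, ⟪e, j g⟫_ℂ = 0 → (Q (S g) (g + z • S g)).im = 0)
    (hSj : ∀ g, ⟪e, j g⟫_ℂ = 0 → (⟪j (S g), j (g + z • S g)⟫_ℂ).im = 0) :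
    ∃ (g : ℕ → E) (ξ : H), (∀ n, ⟪e, j (g n)⟫_ℂ = 0) ∧ Tendsto (fun n => j (g n)) atTop (𝓝 η) ∧
      Tendsto (fun n => j (S (g n))) atTop (𝓝 ξ) ∧ (ξ, (l : ℂ) • ξ) ∈ A.graph := by
  obtain ⟨f, hfη, hfQ, hfv⟩ := (hA _ _).1 hη
  -- From here on, the norm of `E` is the seminorm of `q`, which may be degenerate.
  set q : E →ₗ⋆[ℂ] E →ₗ[ℂ] ℂ := shiftedForm j Q l
  have hqa : ∀ f g, q f g = Q f g - l * ⟪j f, j g⟫_ℂ := shiftedForm_apply j Q l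
  let core : PreInnerProductSpace.Core ℂ E := formCore q (conj_shiftedForm j Q hQ l)
    fun f => by rw [re_shiftedForm_self]; linarith [hl f]
  let : SeminormedAddCommGroup E :=
    InnerProductSpace.Core.toSeminormedAddCommGroup (𝕜 := ℂ) (c := core)
  let : InnerProductSpace ℂ E := InnerProductSpace.ofCore core
  have hinner : ∀ f g : E, ⟪f, g⟫_ℂ = q f g := fun _ _ => rfl
  have hnorm : ∀ f : E, ‖f‖ ^ 2 = (q f f).re := fun f => by
    rw [← hinner]
    exact norm_sq_eq_re_inner (𝕜 := ℂ) f
  have hQadd : ∀ f g, Q f g = ⟪f, g⟫_ℂ + l * ⟪j f, j g⟫_ℂ := fun f g => by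
    rw [hinner, hqa]; ring
  have hfj : Tendsto (fun p : ℕ × ℕ => j (f p.1) - j (f p.2)) atTop (𝓝 0) := by
    have h1 := (hfη.comp tendsto_fst).sub (hfη.comp tendsto_snd)
    rw [prod_atTop_atTop_eq, sub_self] at h1
    exact h1
  have hfc : CauchySeq f := by
    rw [cauchySeq_iff_tendsto_dist_atTop_0]
    simp only [dist_eq_norm]
    have h2 : Tendsto (fun p : ℕ × ℕ => (q (f p.1 - f p.2) (f p.1 - f p.2)).re) atTop (𝓝 0) := by
      have h3 := ((Complex.continuous_re.tendsto _).comp hfQ).sub ((hfj.norm.pow 2).const_mul l)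
      simp only [norm_zero, Complex.zero_re, ne_eq, OfNat.ofNat_ne_zero, not_false_eq_true,
        zero_pow, mul_zero, sub_zero] at h3
      refine h3.congr fun p => ?_
      rw [re_shiftedForm_self, map_sub j]
      rfl
    have h4 := h2.sqrt
    rw [Real.sqrt_zero] at h4
    refine h4.congr fun p => ?_
    rw [← hnorm, Real.sqrt_sq (norm_nonneg _)]
  -- The eigenvalue equation says that `q(v, f n)` tends to `l⟪j v, η⟫ - l⟪j v, η⟫ = 0`.
  have hf0 : Tendsto (fun n => ‖f n‖) atTop (𝓝 0) := by
    refine tendsto_norm_zero_of_cauchySeq_of_inner hfc fun v => ?_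
    have h1 := (hfv v).sub ((tendsto_const_nhds.inner hfη :
      Tendsto (fun n => ⟪j v, j (f n)⟫_ℂ) atTop (𝓝 ⟪j v, η⟫_ℂ)).const_mul (l : ℂ))
    rw [inner_smul_right, sub_self] at h1
    refine h1.congr fun n => ?_
    rw [hinner, hqa]
  have hc : Tendsto (fun n => ⟪e, j (f n)⟫_ℂ) atTop (𝓝 0) := heη ▸ tendsto_const_nhds.inner hfη
  -- A multiple of `χ` makes the orthogonality to `e` exact; the coefficient tends to `⟪e, η⟫ = 0`,
  -- so neither limit changes.
  set g : ℕ → E := fun n => f n - ⟪e, j (f n)⟫_ℂ • χ with hg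
  have hge : ∀ n, ⟪e, j (g n)⟫_ℂ = 0 := fun n => by
    rw [hg, map_sub, map_smul, inner_sub_right, inner_smul_right, hχ, mul_one, sub_self]
  have hgη : Tendsto (fun n => j (g n)) atTop (𝓝 η) := by
    have := hfη.sub (hc.smul_const (j χ))
    rw [zero_smul, sub_zero] at this
    simpa only [hg, map_sub, map_smul] using this
  have hg0 : Tendsto (fun n => ‖g n‖) atTop (𝓝 0) := by
    have h1 := hf0.add (hc.norm.mul_const ‖χ‖)
    rw [norm_zero, zero_mul, add_zero] at h1
    refine squeeze_zero (fun _ => norm_nonneg _) (fun n => ?_) h1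
    exact (norm_sub_le _ _).trans_eq (by rw [norm_smul])
  -- The key estimate `|Im z| ‖S g‖ ≤ ‖g‖`: `q(S g, g + z S g)` is real because both terms of `q`
  -- are.
  have hS0 : Tendsto (fun n => ‖S (g n)‖) atTop (𝓝 0) := by
    have h1 := hg0.const_mul |z.im|⁻¹
    rw [mul_zero] at h1
    refine squeeze_zero (fun _ => norm_nonneg _) (fun n => ?_) h1
    rw [← div_eq_inv_mul, le_div_iff₀ (abs_pos.2 hz), mul_comm]
    refine abs_im_mul_norm_le_of_im_inner_eq_zero ?_
    rw [hinner, hqa, Complex.sub_im, hSQ _ (hge n), Complex.im_ofReal_mul, hSj _ (hge n), mul_zero,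
      sub_zero]
  have hSc : CauchySeq fun n => j (S (g n)) := by
    rw [cauchySeq_iff_tendsto_dist_atTop_0]
    have h1 := (cauchySeq_iff_tendsto_dist_atTop_0.1 hgη.cauchySeq).const_mul C
    rw [mul_zero] at h1
    refine squeeze_zero (fun _ => dist_nonneg) (fun p => ?_) h1
    rw [dist_eq_norm, dist_eq_norm]
    exact hSC _ _ (hge _) (hge _)
  obtain ⟨ξ, hξ⟩ := cauchySeq_tendsto_of_complete hSc
  refine ⟨g, ξ, hge, hgη, hξ, (hA _ _).2 ⟨fun n => S (g n), hξ, ?_, fun v => ?_⟩⟩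
  -- Since `S (g n)` is null for `q`, the form `Q` agrees in the limit with `l⟪j ·, j ·⟫`.
  · have hd : Tendsto (fun p : ℕ × ℕ => ‖S (g p.1) - S (g p.2)‖) atTop (𝓝 0) := by
      have h1 := (hS0.comp tendsto_fst).add (hS0.comp tendsto_snd)
      rw [prod_atTop_atTop_eq, add_zero] at h1
      exact squeeze_zero (fun _ => norm_nonneg _) (fun p => norm_sub_le _ _) h1
    have hdj : Tendsto (fun p : ℕ × ℕ => j (S (g p.1)) - j (S (g p.2))) atTop (𝓝 0) := by
      have h1 := (hξ.comp tendsto_fst).sub (hξ.comp tendsto_snd)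
      rw [prod_atTop_atTop_eq, sub_self] at h1
      exact h1
    have h2 := (hd.pow 2).add ((hdj.norm.pow 2).const_mul |l|)
    simp only [norm_zero, ne_eq, OfNat.ofNat_ne_zero, not_false_eq_true, zero_pow, mul_zero,
      add_zero] at h2
    refine squeeze_zero_norm (fun p => ?_) h2
    rw [hQadd, map_sub j]
    refine (norm_add_le _ _).trans ?_
    rw [norm_mul, Complex.norm_real, Real.norm_eq_abs]
    gcongr
    · exact (norm_inner_le_norm _ _).trans_eq (sq _).symm
    · exact (norm_inner_le_norm _ _).trans_eq (sq _).symm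
  · have h1 : Tendsto (fun n => ⟪v, S (g n)⟫_ℂ) atTop (𝓝 0) := by
      have h2 := hS0.const_mul ‖v‖
      rw [mul_zero] at h2
      exact squeeze_zero_norm (fun n => norm_inner_le_norm _ _) h2
    have h3 := h1.add ((tendsto_const_nhds.inner hξ :
      Tendsto (fun n => ⟪j v, j (S (g n))⟫_ℂ) atTop (𝓝 ⟪j v, ξ⟫_ℂ)).const_mul (l : ℂ))
    rw [zero_add, ← inner_smul_right] at h3
    exact h3.congr fun n => (hQadd _ _).symm

end Eigenvector

/-! ### Algebra of the kernel form -/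

section KernelForm

variable {L : ℝ}

/-! ### Linearity and reality of the pairing -/

namespace RealDistribution

theorem pairing_congr (D : RealDistribution L) {φ ψ : ℝ → ℂ} (hφ : ContDiffOn ℝ ∞ φ (Icc 0 L))
    (hψ : ContDiffOn ℝ ∞ ψ (Icc 0 L)) (h : φ = ψ) : D.pairing φ hφ = D.pairing ψ hψ := by
  subst h
  rfl

theorem pairing_add (D : RealDistribution L) {φ ψ : ℝ → ℂ} (hφ : ContDiffOn ℝ ∞ φ (Icc 0 L))
    (hψ : ContDiffOn ℝ ∞ ψ (Icc 0 L)) (h : ContDiffOn ℝ ∞ (fun t => φ t + ψ t) (Icc 0 L)) :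
    D.pairing (fun t => φ t + ψ t) h = D.pairing φ hφ + D.pairing ψ hψ := by
  have hre := D.toLin.map_add ⟨fun t => (φ t).re, Complex.reCLM.contDiff.comp_contDiffOn hφ⟩
    ⟨fun t => (ψ t).re, Complex.reCLM.contDiff.comp_contDiffOn hψ⟩
  have him := D.toLin.map_add ⟨fun t => (φ t).im, Complex.imCLM.contDiff.comp_contDiffOn hφ⟩
    ⟨fun t => (ψ t).im, Complex.imCLM.contDiff.comp_contDiffOn hψ⟩
  rw [pairing, pairing, pairing]
  have e := congrArg₂ (fun a b : ℝ => (a : ℂ) + b * Complex.I) hre him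
  refine Eq.trans e ?_
  push_cast
  ring

theorem pairing_smul (D : RealDistribution L) (c : ℂ) {φ : ℝ → ℂ}
    (hφ : ContDiffOn ℝ ∞ φ (Icc 0 L)) (h : ContDiffOn ℝ ∞ (fun t => c * φ t) (Icc 0 L)) :
    D.pairing (fun t => c * φ t) h = c * D.pairing φ hφ := by
  set u : smoothOn L := ⟨fun t => (φ t).re, Complex.reCLM.contDiff.comp_contDiffOn hφ⟩ with hu
  set v : smoothOn L := ⟨fun t => (φ t).im, Complex.imCLM.contDiff.comp_contDiffOn hφ⟩ with hv
  have hre : (⟨fun t => (c * φ t).re, Complex.reCLM.contDiff.comp_contDiffOn h⟩ : smoothOn L) =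
      c.re • u - c.im • v := Subtype.ext (funext fun t => Complex.mul_re _ _)
  have him : (⟨fun t => (c * φ t).im, Complex.imCLM.contDiff.comp_contDiffOn h⟩ : smoothOn L) =
      c.re • v + c.im • u := Subtype.ext (funext fun t => Complex.mul_im _ _)
  rw [pairing, pairing, hre, him]
  simp only [map_sub, map_add, map_smul, smul_eq_mul, ← hu, ← hv]
  apply Complex.ext <;> simp

theorem pairing_conj (D : RealDistribution L) {φ : ℝ → ℂ}
    (hφ : ContDiffOn ℝ ∞ φ (Icc 0 L)) (h : ContDiffOn ℝ ∞ (fun t => conj (φ t)) (Icc 0 L)) :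
    D.pairing (fun t => conj (φ t)) h = conj (D.pairing φ hφ) := by
  set v : smoothOn L := ⟨fun t => (φ t).im, Complex.imCLM.contDiff.comp_contDiffOn hφ⟩ with hv
  have him : (⟨fun t => (conj (φ t)).im, Complex.imCLM.contDiff.comp_contDiffOn h⟩ : smoothOn L) =
      -v := Subtype.ext (funext fun t => Complex.conj_im _)
  rw [pairing, pairing, him]
  simp only [map_neg, ← hv, Complex.conj_re]
  apply Complex.ext <;> simp

end RealDistribution

/-! ### Sesquilinearity and hermitian symmetry of the form -/

theorem integrableOn_correlation (L t : ℝ) (f g : smoothFunctions) :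
    IntegrableOn (fun y => conj ((f : ℝ → ℂ) (y + t)) * (g : ℝ → ℂ) y)
      {y : ℝ | y ∈ Icc (-L / 2) (L / 2) ∧ y + t ∈ Icc (-L / 2) (L / 2)} := by
  have hf : Continuous (f : ℝ → ℂ) := ContDiff.continuous (n := ∞) f.2
  have hg : Continuous (g : ℝ → ℂ) := ContDiff.continuous (n := ∞) g.2
  have hc : Continuous fun y => conj ((f : ℝ → ℂ) (y + t)) * (g : ℝ → ℂ) y :=
    (Complex.continuous_conj.comp (hf.comp (continuous_id.add continuous_const))).mul hg
  exact (hc.continuousOn.integrableOn_compact (isCompact_Icc (a := -L / 2) (b := L / 2))).mono_set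
    fun y hy => hy.1

theorem correlation_add_right (L t : ℝ) (f g h : smoothFunctions) :
    correlation L f ((g + h : smoothFunctions) : ℝ → ℂ) t =
      correlation L f g t + correlation L f h t := by
  rw [correlation, correlation, correlation,
    ← integral_add (integrableOn_correlation L t f g) (integrableOn_correlation L t f h)]
  simp [mul_add]

theorem correlation_smul_right (L t : ℝ) (c : ℂ) (f g : smoothFunctions) :
    correlation L f ((c • g : smoothFunctions) : ℝ → ℂ) t = c * correlation L f g t := by
  rw [correlation, correlation, ← integral_const_mul]
  congr 1 with y
  simp
  ring

theorem correlation_swap (L t : ℝ) (f g : ℝ → ℂ) :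
    correlation L g f t = conj (correlation L f g (-t)) := by
  rw [correlation_neg, Complex.conj_conj]

/-- This is how the translation invariance of the kernel enters: identities between correlations
become identities of `Q`. -/
theorem kernelForm_congr (D : RealDistribution L) {f g f' g' : smoothFunctions}
    (h : correlation L f g = correlation L f' g') : kernelForm D f g = kernelForm D f' g' := by
  rw [kernelForm, kernelForm, RealDistribution.evenExtension, RealDistribution.evenExtension]
  congr 1
  · exact D.pairing_congr _ _ h
  · exact D.pairing_congr _ _ (by rw [h])

theorem kernelForm_add_right (D : RealDistribution L) (f g h : smoothFunctions) :
    kernelForm D f (g + h) = kernelForm D f g + kernelForm D f h := by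
  have h1 := contDiffOn_correlation_pos L f g
  have h2 := contDiffOn_correlation_pos L f h
  have h3 := RealDistribution.contDiffOn_comp_neg (contDiffOn_correlation_neg L f g)
  have h4 := RealDistribution.contDiffOn_comp_neg (contDiffOn_correlation_neg L f h)
  have e1 := D.pairing_congr (contDiffOn_correlation_pos L f (g + h)) (h1.add h2)
    (funext fun t => correlation_add_right L t f g h)
  have e2 := D.pairing_congr
    (RealDistribution.contDiffOn_comp_neg (contDiffOn_correlation_neg L f (g + h))) (h3.add h4)
    (funext fun t => correlation_add_right L (-t) f g h)
  simp only [kernelForm, RealDistribution.evenExtension]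
  rw [e1, e2]
  erw [D.pairing_add h1 h2, D.pairing_add h3 h4]
  ring

theorem kernelForm_smul_right (D : RealDistribution L) (c : ℂ) (f g : smoothFunctions) :
    kernelForm D f (c • g) = c * kernelForm D f g := by
  have h1 := contDiffOn_correlation_pos L f g
  have h3 := RealDistribution.contDiffOn_comp_neg (contDiffOn_correlation_neg L f g)
  have e1 := D.pairing_congr (contDiffOn_correlation_pos L f (c • g)) (contDiffOn_const.mul h1)
    (funext fun t => correlation_smul_right L t c f g)
  have e2 := D.pairing_congr
    (RealDistribution.contDiffOn_comp_neg (contDiffOn_correlation_neg L f (c • g)))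
    (contDiffOn_const.mul h3) (funext fun t => correlation_smul_right L (-t) c f g)
  simp only [kernelForm, RealDistribution.evenExtension]
  rw [e1, e2]
  erw [D.pairing_smul c h1, D.pairing_smul c h3]
  ring

/-- The kernel form is hermitian. -/
theorem conj_kernelForm (D : RealDistribution L) (f g : smoothFunctions) :
    conj (kernelForm D f g) = kernelForm D g f := by
  have h1 := contDiffOn_correlation_pos L f g
  have h3 := RealDistribution.contDiffOn_comp_neg (contDiffOn_correlation_neg L f g)
  have c1 : ContDiffOn ℝ ∞ (fun t => conj (correlation L f g t)) (Icc 0 L) :=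
    Complex.conjCLE.contDiff.comp_contDiffOn h1
  have c3 : ContDiffOn ℝ ∞ (fun t => conj (correlation L f g (-t))) (Icc 0 L) :=
    Complex.conjCLE.contDiff.comp_contDiffOn h3
  simp only [kernelForm, RealDistribution.evenExtension]
  -- Exchanging `f` and `g` conjugates the correlation and reflects `t`, so the two halves of `D̃`
  -- trade places.
  rw [map_add, ← D.pairing_conj h1 c1, ← D.pairing_conj h3 c3, add_comm]
  congr 1
  · exact D.pairing_congr _ _ (funext fun t => (correlation_swap L t f g).symm)
  · exact D.pairing_congr _ _ (funext fun t => (correlation_neg L g f t).symm)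

theorem kernelForm_add_left (D : RealDistribution L) (f g h : smoothFunctions) :
    kernelForm D (f + g) h = kernelForm D f h + kernelForm D g h := by
  rw [← conj_kernelForm, kernelForm_add_right, map_add, conj_kernelForm, conj_kernelForm]

theorem kernelForm_smul_left (D : RealDistribution L) (c : ℂ) (f g : smoothFunctions) :
    kernelForm D (c • f) g = conj c * kernelForm D f g := by
  rw [← conj_kernelForm, kernelForm_smul_right, map_mul, conj_kernelForm]

/-- The kernel form as a sesquilinear map on a space of test functions. -/
noncomputable def kernelSesq (D : RealDistribution L) (V : Submodule ℂ smoothFunctions) :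
    V →ₗ⋆[ℂ] V →ₗ[ℂ] ℂ :=
  LinearMap.mk₂'ₛₗ _ _ (fun f g => kernelForm D f g) (fun f g h => kernelForm_add_left D f g h)
    (fun c f g => kernelForm_smul_left D c f g) (fun f g h => kernelForm_add_right D f g h)
    (fun c f g => kernelForm_smul_right D c f g)

/-- Through this value at `0`, a correlation identity serves the inner product as well as `Q`. -/
theorem correlation_zero (f g : smoothFunctions) :
    correlation L f g 0 = ⟪toL2 L f, toL2 L g⟫_ℂ := by
  have hset : {y : ℝ | y ∈ Icc (-L / 2) (L / 2) ∧ y + 0 ∈ Icc (-L / 2) (L / 2)} =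
      Icc (-L / 2) (L / 2) := by
    ext y
    simp
  rw [correlation, hset, L2.inner_def]
  refine integral_congr_ae ?_
  filter_upwards [(memLp_smooth L f).coeFn_toLp, (memLp_smooth L g).coeFn_toLp] with y hf hg
  change _ = ⟪(memLp_smooth L f).toLp _ y, (memLp_smooth L g).toLp _ y⟫_ℂ
  rw [hf, hg, add_zero, RCLike.inner_apply, mul_comm]

theorem correlation_eq_zero_of_lt {t : ℝ} (f g : ℝ → ℂ) (h : L < t) : correlation L f g t = 0 := by
  have hset : {y : ℝ | y ∈ Icc (-L / 2) (L / 2) ∧ y + t ∈ Icc (-L / 2) (L / 2)} = ∅ := by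
    ext y
    simp only [mem_Icc, mem_ofPred_eq, mem_empty_iff_false, iff_false]
    rintro ⟨⟨h1, h2⟩, h3, h4⟩
    linarith
  rw [correlation, hset, setIntegral_empty]

/-- The operator `-i d/dx` is symmetric for correlations with a function that vanishes at both
endpoints. -/
theorem correlation_neg_I_deriv (f p : smoothFunctions)
    (hd : ∀ x, HasDerivAt (f : ℝ → ℂ) (Complex.I * (p : ℝ → ℂ) x) x)
    (h₁ : (f : ℝ → ℂ) (-L / 2) = 0) (h₂ : (f : ℝ → ℂ) (L / 2) = 0) :
    correlation L p f = correlation L f p := by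
  have hf : Continuous (f : ℝ → ℂ) := ContDiff.continuous (n := ∞) f.2
  have hp : Continuous (p : ℝ → ℂ) := ContDiff.continuous (n := ∞) p.2
  have hnonneg : ∀ t, 0 ≤ t → correlation L p f t = correlation L f p t := fun t ht => by
    rcases lt_or_ge L t with hLt | hLt
    · rw [correlation_eq_zero_of_lt _ _ hLt, correlation_eq_zero_of_lt _ _ hLt]
    rw [correlation_of_nonneg _ _ ⟨ht, hLt⟩, correlation_of_nonneg _ _ ⟨ht, hLt⟩, ← sub_eq_zero,
      ← intervalIntegral.integral_sub]
    · have hder : ∀ y, HasDerivAt (fun y => Complex.I * (conj ((f : ℝ → ℂ) (y + t)) *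
          (f : ℝ → ℂ) y)) (conj ((p : ℝ → ℂ) (y + t)) * (f : ℝ → ℂ) y -
            conj ((f : ℝ → ℂ) (y + t)) * (p : ℝ → ℂ) y) y := fun y => by
        have h3 : HasDerivAt (fun y => conj ((f : ℝ → ℂ) (y + t)))
            (conj (Complex.I * (p : ℝ → ℂ) (y + t))) y :=
          (Complex.conjCLE.hasFDerivAt.comp_hasDerivAt y ((hd (y + t)).comp_add_const y t))
        refine ((h3.mul (hd y)).const_mul Complex.I).congr_deriv ?_
        rw [map_mul, Complex.conj_I]
        linear_combination (conj ((f : ℝ → ℂ) (y + t)) * (p : ℝ → ℂ) y -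
          conj ((p : ℝ → ℂ) (y + t)) * (f : ℝ → ℂ) y) * Complex.I_mul_I
      -- The boundary terms vanish: at `y = L/2 - t` the factor `f (y + t)` is `f (L/2)`, and at `y
      -- = -L/2` the factor `f y` is `f (-L/2)`.
      rw [intervalIntegral.integral_eq_sub_of_hasDerivAt fun y _ => hder y]
      · rw [sub_add_cancel, h₁, h₂]
        simp
      · refine Continuous.intervalIntegrable ?_ _ _
        exact ((Complex.continuous_conj.comp (hp.comp (continuous_add_const t))).mul hf).sub
          ((Complex.continuous_conj.comp (hf.comp (continuous_add_const t))).mul hp)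
    · exact ((Complex.continuous_conj.comp (hp.comp (continuous_add_const t))).mul
        hf).intervalIntegrable _ _
    · exact ((Complex.continuous_conj.comp (hf.comp (continuous_add_const t))).mul
        hp).intervalIntegrable _ _
  ext t
  rcases le_total 0 t with ht | ht
  · exact hnonneg t ht
  · rw [correlation_swap, correlation_swap L t p f, hnonneg _ (neg_nonneg.2 ht)]

theorem im_kernelForm_neg_I_deriv (D : RealDistribution L) (f p : smoothFunctions)
    (hd : ∀ x, HasDerivAt (f : ℝ → ℂ) (Complex.I * (p : ℝ → ℂ) x) x)
    (h₁ : (f : ℝ → ℂ) (-L / 2) = 0) (h₂ : (f : ℝ → ℂ) (L / 2) = 0) :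
    (kernelForm D f p).im = 0 := by
  rw [← Complex.conj_eq_iff_im, conj_kernelForm]
  exact kernelForm_congr D (correlation_neg_I_deriv f p hd h₁ h₂)

theorem im_inner_neg_I_deriv (f p : smoothFunctions)
    (hd : ∀ x, HasDerivAt (f : ℝ → ℂ) (Complex.I * (p : ℝ → ℂ) x) x)
    (h₁ : (f : ℝ → ℂ) (-L / 2) = 0) (h₂ : (f : ℝ → ℂ) (L / 2) = 0) :
    (⟪toL2 L f, toL2 L p⟫_ℂ).im = 0 := by
  rw [← Complex.conj_eq_iff_im, inner_conj_symm, ← correlation_zero, ← correlation_zero,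
    correlation_neg_I_deriv f p hd h₁ h₂]

end KernelForm

/-! ### The Fourier transform on `L²([-L/2, L/2])` -/

section Fourier

variable {L : ℝ}

/-- The function `x ↦ exp (i z x)`. -/
noncomputable def expFun (z : ℂ) : smoothFunctions :=
  ⟨fun x => Complex.exp (Complex.I * z * x), by
    change ContDiff ℝ ∞ _
    exact (contDiff_const.mul Complex.ofRealCLM.contDiff).cexp⟩

theorem expFun_apply (z : ℂ) (x : ℝ) :
    (expFun z : ℝ → ℂ) x = Complex.exp (Complex.I * z * x) := rfl

theorem conj_expFun_conj (z : ℂ) (x : ℝ) :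
    conj ((expFun (conj z) : ℝ → ℂ) x) = Complex.exp (-Complex.I * z * x) := by
  rw [expFun_apply, ← Complex.exp_conj]
  simp

/-- Makes evaluation of the transform at a complex point continuous on `L²`, and turns the condition
`η̂(z) = 0` into orthogonality to one vector. -/
theorem fourier_eq_inner (η : L2 L) (z : ℂ) :
    fourier η z = ⟪toL2 L (expFun (conj z)), η⟫_ℂ := by
  rw [fourier, L2.inner_def]
  refine integral_congr_ae ?_
  filter_upwards [(memLp_smooth L (expFun (conj z))).coeFn_toLp] with x hx
  change _ = ⟪(memLp_smooth L (expFun (conj z))).toLp _ x, η x⟫_ℂ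
  rw [hx, RCLike.inner_apply, conj_expFun_conj]

theorem fourier_toL2 (hL : 0 < L) (f : smoothFunctions) (z : ℂ) :
    fourier (toL2 L f) z =
      ∫ x in (-L / 2)..(L / 2), (f : ℝ → ℂ) x * Complex.exp (-Complex.I * z * x) := by
  rw [fourier, intervalIntegral.integral_of_le (by linarith), ← integral_Icc_eq_integral_Ioc]
  refine integral_congr_ae ?_
  filter_upwards [(memLp_smooth L f).coeFn_toLp] with x hx
  change (memLp_smooth L f).toLp _ x * _ = _
  rw [hx]

theorem integrable_L2 (η : L2 L) : Integrable η (intervalMeasure L) :=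
  (Lp.memLp η).integrable one_le_two

/-- Differentiation under the integral sign: on a bounded interval, the exponential and its
`z`-derivative are bounded uniformly for `z` in a unit ball. -/
theorem differentiable_fourier (η : L2 L) : Differentiable ℂ (fourier η) := by
  intro z₀
  have hbd : ∀ z ∈ Metric.ball z₀ 1, ∀ x ∈ Icc (-L / 2) (L / 2),
      ‖η x * (Complex.exp (-Complex.I * z * x) * (-Complex.I * x))‖ ≤
        ‖η x‖ * (Real.exp ((‖z₀‖ + 1) * (L / 2)) * (L / 2)) := fun z hz x hx => by
    have hx' : |x| ≤ L / 2 := abs_le.2 ⟨by linarith [hx.1], hx.2⟩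
    have hz' : ‖z‖ ≤ ‖z₀‖ + 1 := by
      have := norm_sub_norm_le z z₀
      rw [mem_ball_iff_norm] at hz
      linarith
    rw [norm_mul, norm_mul]
    gcongr
    · refine (Complex.norm_exp_le_exp_norm _).trans (Real.exp_le_exp.2 ?_)
      rw [norm_mul, norm_mul, norm_neg, Complex.norm_I, one_mul, Complex.norm_real, Real.norm_eq_abs]
      gcongr
    · rw [norm_mul, norm_neg, Complex.norm_I, one_mul, Complex.norm_real, Real.norm_eq_abs]
      exact hx'
  have hmeas : ∀ z : ℂ, AEStronglyMeasurable
      (fun x : ℝ => η x * Complex.exp (-Complex.I * z * x)) (intervalMeasure L) := fun z =>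
    (integrable_L2 η).aestronglyMeasurable.mul
      (Continuous.aestronglyMeasurable (by fun_prop))
  have hint : Integrable (fun x : ℝ => η x * Complex.exp (-Complex.I * z₀ * x))
      (intervalMeasure L) := by
    refine ((integrable_L2 η).norm.mul_const (Real.exp (‖z₀‖ * (L / 2)))).mono' (hmeas z₀)
      ((ae_restrict_iff' measurableSet_Icc).2 (Eventually.of_forall fun x hx => ?_))
    have hx' : |x| ≤ L / 2 := abs_le.2 ⟨by linarith [hx.1], hx.2⟩
    rw [norm_mul]
    gcongr
    refine (Complex.norm_exp_le_exp_norm _).trans (Real.exp_le_exp.2 ?_)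
    rw [norm_mul, norm_mul, norm_neg, Complex.norm_I, one_mul, Complex.norm_real, Real.norm_eq_abs]
    gcongr
  refine (hasDerivAt_integral_of_dominated_loc_of_deriv_le
    (F := fun (z : ℂ) (x : ℝ) => η x * Complex.exp (-Complex.I * z * x))
    (F' := fun (z : ℂ) (x : ℝ) => η x * (Complex.exp (-Complex.I * z * x) * (-Complex.I * x)))
    (bound := fun x => ‖η x‖ * (Real.exp ((‖z₀‖ + 1) * (L / 2)) * (L / 2)))
    (Metric.ball_mem_nhds z₀ one_pos) (Eventually.of_forall hmeas) hint ?_ ?_ ?_ ?_).2.differentiableAt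
  · exact (integrable_L2 η).aestronglyMeasurable.mul
      (Continuous.aestronglyMeasurable (by fun_prop))
  · exact (ae_restrict_iff' measurableSet_Icc).2
      (Eventually.of_forall fun x hx z hz => hbd z hz x hx)
  · exact (integrable_L2 η).norm.mul_const _
  · refine Eventually.of_forall fun x z _ => ?_
    have h1 : HasDerivAt (fun z : ℂ => -Complex.I * z * x) (-Complex.I * x) z := by
      simpa using ((hasDerivAt_id z).const_mul (-Complex.I)).mul_const (x : ℂ)
    exact h1.cexp.const_mul _

open FourierTransform in
/-- An integrable function whose Fourier transform vanishes almost everywhere vanishes almost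
everywhere. -/
theorem ae_eq_zero_of_fourier_ae_eq_zero {f : ℝ → ℂ} (hf : Integrable f)
    (h : ∀ᵐ w : ℝ, 𝓕 f w = 0) : ∀ᵐ x : ℝ, f x = 0 := by
  refine ae_eq_zero_of_integral_contDiff_smul_eq_zero hf.locallyIntegrable fun g hg hgc => ?_
  have hg₁ : HasCompactSupport (Complex.ofRealCLM ∘ g) := hgc.comp_left rfl
  have hg₂ : ContDiff ℝ ∞ (Complex.ofRealCLM ∘ g) := by fun_prop
  -- Any test function `g` is the transform of a Schwartz function `h'`, so by duality `∫ g f = ∫ h'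
  -- 𝓕 f = 0`.
  set G : SchwartzMap ℝ ℂ := hg₁.toSchwartzMap hg₂
  have hG : ∀ x, G x = g x := fun _ => rfl
  set h' : SchwartzMap ℝ ℂ := 𝓕⁻ G
  have hh : 𝓕 (h' : ℝ → ℂ) = G := by
    rw [← SchwartzMap.fourier_coe, FourierTransform.fourier_fourierInv_eq]
  have key : ∫ ξ, 𝓕 (h' : ℝ → ℂ) ξ • f ξ = ∫ x, h' x • 𝓕 f x := by
    simpa using! VectorFourier.integral_fourierIntegral_smul_eq_flip (L := innerₗ ℝ)
      Real.continuous_fourierChar continuous_inner h'.integrable hf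
  rw [hh] at key
  have h0 : ∫ x, h' x • 𝓕 f x = 0 := by
    refine integral_eq_zero_of_ae ?_
    filter_upwards [h] with x hx
    rw [hx, smul_zero]
    rfl
  rw [h0] at key
  rw [← key]
  congr 1

/-- If the Fourier transform of `η` vanishes on the real line with the exception of at most one
point, then `η = 0`. -/
theorem eq_zero_of_fourier_eq_zero (η : L2 L) {w₀ : ℂ}
    (h : ∀ w : ℝ, (w : ℂ) ≠ w₀ → fourier η w = 0) : η = 0 := by
  have hint : Integrable ((Icc (-L / 2) (L / 2)).indicator η) :=
    (integrable_indicator_iff measurableSet_Icc).2 (integrable_L2 η)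
  have hF : ∀ w : ℝ, FourierTransform.fourier ((Icc (-L / 2) (L / 2)).indicator η) w =
      fourier η ((2 * Real.pi * w : ℝ) : ℂ) := fun w => by
    rw [Real.fourier_real_eq_integral_exp_smul, fourier, ← integral_indicator measurableSet_Icc]
    congr 1 with x
    by_cases hx : x ∈ Icc (-L / 2) (L / 2)
    · rw [indicator_of_mem hx, indicator_of_mem hx, smul_eq_mul, mul_comm]
      congr 2
      push_cast
      ring
    · rw [indicator_of_notMem hx, indicator_of_notMem hx, smul_zero]
  have hsub : {w : ℝ | ¬ FourierTransform.fourier ((Icc (-L / 2) (L / 2)).indicator η) w =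
      0}.Subsingleton := by
    have hw : ∀ w ∈ {w : ℝ | ¬ FourierTransform.fourier ((Icc (-L / 2) (L / 2)).indicator η) w =
      0}, ((2 * Real.pi * w : ℝ) : ℂ) = w₀ := fun w hw => by
      by_contra hne
      exact hw ((hF w).trans (h _ hne))
    intro a ha b hb
    have := (hw a ha).trans (hw b hb).symm
    exact mul_left_cancel₀ (mul_ne_zero two_ne_zero Real.pi_ne_zero) (Complex.ofReal_injective this)
  have h0 := ae_eq_zero_of_fourier_ae_eq_zero hint (hsub.measure_zero volume)
  rw [Lp.eq_zero_iff_ae_eq_zero]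
  refine (ae_restrict_iff' measurableSet_Icc).2 ?_
  filter_upwards [h0] with x hx hxI
  rwa [indicator_of_mem hxI] at hx

end Fourier

/-! ### Inverting `-i d/dx - z` -/

section Primitive

variable {L : ℝ}

theorem contDiff_integral {f : ℝ → ℂ} (hf : ContDiff ℝ ∞ f) (a : ℝ) :
    ContDiff ℝ ∞ fun x => ∫ y in a..x, f y := by
  have hd : ∀ x, HasDerivAt (fun x => ∫ y in a..x, f y) (f x) x := fun x =>
    intervalIntegral.integral_hasDerivAt_right (hf.continuous.intervalIntegrable _ _)
      hf.continuous.stronglyMeasurable.stronglyMeasurableAtFilter hf.continuous.continuousAt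
  rw [contDiff_infty_iff_deriv]
  refine ⟨fun x => (hd x).differentiableAt, ?_⟩
  rw [funext fun x => (hd x).deriv]
  exact hf

theorem contDiff_mul_exp (f : smoothFunctions) (z : ℂ) :
    ContDiff ℝ ∞ fun y : ℝ => (f : ℝ → ℂ) y * Complex.exp (-Complex.I * z * y) := by
  have hf : ContDiff ℝ ∞ (f : ℝ → ℂ) := f.2
  exact hf.mul (contDiff_const.mul Complex.ofRealCLM.contDiff).cexp

/-- The solution of `-i u' - z u = f` that vanishes at `-L/2`. -/
noncomputable def resolventFun (L : ℝ) (z : ℂ) (f : smoothFunctions) : smoothFunctions :=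
  ⟨fun x => Complex.exp (Complex.I * z * x) * (Complex.I *
      ∫ y in (-L / 2)..x, (f : ℝ → ℂ) y * Complex.exp (-Complex.I * z * y)), by
    change ContDiff ℝ ∞ _
    exact ContDiff.mul (expFun z).2 (contDiff_const.mul
      (contDiff_integral (contDiff_mul_exp f z) _))⟩

theorem resolventFun_apply (L : ℝ) (z : ℂ) (f : smoothFunctions) (x : ℝ) :
    (resolventFun L z f : ℝ → ℂ) x = Complex.exp (Complex.I * z * x) * (Complex.I *
      ∫ y in (-L / 2)..x, (f : ℝ → ℂ) y * Complex.exp (-Complex.I * z * y)) := rfl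

theorem hasDerivAt_resolventFun (z : ℂ) (f : smoothFunctions) (x : ℝ) :
    HasDerivAt (resolventFun L z f : ℝ → ℂ)
      (Complex.I * ((f + z • resolventFun L z f : smoothFunctions) : ℝ → ℂ) x) x := by
  have hc := (contDiff_mul_exp f z).continuous
  have h1 : HasDerivAt (fun x => ∫ y in (-L / 2)..x, (f : ℝ → ℂ) y *
      Complex.exp (-Complex.I * z * y)) ((f : ℝ → ℂ) x * Complex.exp (-Complex.I * z * x)) x :=
    intervalIntegral.integral_hasDerivAt_right (hc.intervalIntegrable _ _)
      hc.stronglyMeasurable.stronglyMeasurableAtFilter hc.continuousAt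
  have h2 : HasDerivAt (fun x : ℝ => Complex.I * z * x) (Complex.I * z) x := by
    simpa using (Complex.ofRealCLM.hasDerivAt (x := x)).const_mul (Complex.I * z)
  refine (h2.cexp.mul (h1.const_mul Complex.I)).congr_deriv ?_
  have h3 : Complex.exp (Complex.I * z * x) * Complex.exp (-Complex.I * z * x) = 1 := by
    rw [← Complex.exp_add]
    simp
  change _ = Complex.I * ((f : ℝ → ℂ) x + z * (resolventFun L z f : ℝ → ℂ) x)
  rw [resolventFun_apply]
  linear_combination Complex.I * (f : ℝ → ℂ) x * h3

theorem resolventFun_left (z : ℂ) (f : smoothFunctions) :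
    (resolventFun L z f : ℝ → ℂ) (-L / 2) = 0 := by
  rw [resolventFun_apply, intervalIntegral.integral_same, mul_zero, mul_zero]

/-- Up to the nonzero factor `i exp(i z L/2)`, the value at `L/2` is the transform of `f` at `z`. -/
theorem resolventFun_right (hL : 0 < L) {z : ℂ} {f : smoothFunctions}
    (h : fourier (toL2 L f) z = 0) : (resolventFun L z f : ℝ → ℂ) (L / 2) = 0 := by
  rw [resolventFun_apply, ← fourier_toL2 hL, h, mul_zero, mul_zero]

theorem resolventFun_eq_of_fourier_eq_zero (hL : 0 < L) {z : ℂ} {f : smoothFunctions}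
    (h : fourier (toL2 L f) z = 0) (x : ℝ) :
    (resolventFun L z f : ℝ → ℂ) x = Complex.exp (Complex.I * z * x) * (Complex.I *
      ∫ y in (L / 2)..x, (f : ℝ → ℂ) y * Complex.exp (-Complex.I * z * y)) := by
  have hc := (contDiff_mul_exp f z).continuous
  rw [fourier_toL2 hL] at h
  rw [resolventFun_apply, ← intervalIntegral.integral_add_adjacent_intervals
    (hc.intervalIntegrable (-L / 2) (L / 2)) (hc.intervalIntegrable _ x), h, zero_add]

/-- To the left of the support of `f` the primitive based at `-L/2` vanishes; to the right, the one
based at `L/2` does, and the two coincide. -/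
theorem resolventFun_mem_compactlySupported (hL : 0 < L) {z : ℂ} {f : smoothFunctions}
    (hf : f ∈ compactlySupported L) (h : fourier (toL2 L f) z = 0) :
    resolventFun L z f ∈ compactlySupported L := by
  have hf' : tsupport (f : ℝ → ℂ) ⊆ Ioo (-L / 2) (L / 2) := hf
  have hK : IsCompact (tsupport (f : ℝ → ℂ)) :=
    isCompact_Icc.of_isClosed_subset (isClosed_tsupport _) (hf'.trans Ioo_subset_Icc_self)
  obtain ⟨a, b, ha, hb, hab⟩ : ∃ a b, -L / 2 < a ∧ b < L / 2 ∧
      tsupport (f : ℝ → ℂ) ⊆ Icc a b := by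
    rcases (tsupport (f : ℝ → ℂ)).eq_empty_or_nonempty with he | hne
    · exact ⟨0, 0, by linarith, by linarith, he ▸ empty_subset _⟩
    · obtain ⟨a, ha, ha'⟩ := hK.exists_isLeast hne
      obtain ⟨b, hb, hb'⟩ := hK.exists_isGreatest hne
      exact ⟨a, b, (hf' ha).1, (hf' hb).2, fun x hx => ⟨ha' hx, hb' hx⟩⟩
  have hz : ∀ y, y ∉ Icc a b → (f : ℝ → ℂ) y * Complex.exp (-Complex.I * z * y) = 0 :=
    fun y hy => by rw [image_eq_zero_of_notMem_tsupport fun h => hy (hab h), zero_mul]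
  change tsupport (resolventFun L z f : ℝ → ℂ) ⊆ _
  refine (closure_minimal (fun x hx => ?_) isClosed_Icc).trans (Icc_subset_Ioo ha hb)
  by_contra hxI
  refine hx ?_
  rcases lt_or_ge x a with hxa | hxa
  · rw [resolventFun_apply, intervalIntegral.integral_zero_ae, mul_zero, mul_zero]
    refine Eventually.of_forall fun y hy => hz y fun hy' => ?_
    have := (uIoc_subset_uIcc hy).2
    exact absurd (this.trans_lt (max_lt ha hxa)) (not_lt.2 hy'.1)
  · have hxb : b < x := not_le.1 fun hb => hxI ⟨hxa, hb⟩
    rw [resolventFun_eq_of_fourier_eq_zero hL h, intervalIntegral.integral_zero_ae, mul_zero,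
      mul_zero]
    refine Eventually.of_forall fun y hy => hz y fun hy' => ?_
    have := (uIoc_subset_uIcc hy).1
    exact absurd ((lt_min hb hxb).trans_le this) (not_lt.2 hy'.2)

/-- Translation by `L` carries the primitive based at `-L/2` to the one based at `L/2`, up to a
factor `exp(-i z L)` that the exponential prefactor cancels. -/
theorem resolventFun_mem_smoothPeriodic (hL : 0 < L) {z : ℂ} {f : smoothFunctions}
    (hf : f ∈ smoothPeriodic L) (h : fourier (toL2 L f) z = 0) :
    resolventFun L z f ∈ smoothPeriodic L := by
  have hf' : Function.Periodic (f : ℝ → ℂ) L := hf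
  intro x
  rw [resolventFun_eq_of_fourier_eq_zero hL h, resolventFun_apply]
  have h1 := intervalIntegral.integral_comp_add_right (a := -L / 2) (b := x)
    (fun y : ℝ => (f : ℝ → ℂ) y * Complex.exp (-Complex.I * z * y)) L
  rw [show -L / 2 + L = L / 2 by ring] at h1
  rw [← h1]
  have h2 : ∀ y : ℝ, (f : ℝ → ℂ) (y + L) * Complex.exp (-Complex.I * z * (y + L : ℝ)) =
      Complex.exp (-Complex.I * z * L) * ((f : ℝ → ℂ) y * Complex.exp (-Complex.I * z * y)) :=
    fun y => by
      rw [hf' y, show -Complex.I * z * (y + L : ℝ) = -Complex.I * z * L + -Complex.I * z * y by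
        push_cast; ring, Complex.exp_add]
      ring
  simp only [h2]
  rw [intervalIntegral.integral_const_mul]
  have h3 : Complex.exp (Complex.I * z * (x + L : ℝ)) * Complex.exp (-Complex.I * z * L) =
      Complex.exp (Complex.I * z * x) := by
    rw [← Complex.exp_add]
    congr 1
    push_cast
    ring
  rw [← h3]
  ring

theorem resolventFun_sub (z : ℂ) (f g : smoothFunctions) :
    resolventFun L z f - resolventFun L z g = resolventFun L z (f - g) := by
  refine Subtype.ext (funext fun x => ?_)
  change (resolventFun L z f : ℝ → ℂ) x - (resolventFun L z g : ℝ → ℂ) x = _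
  rw [resolventFun_apply, resolventFun_apply, resolventFun_apply]
  have h : ∀ y, ((f - g : smoothFunctions) : ℝ → ℂ) y = (f : ℝ → ℂ) y - (g : ℝ → ℂ) y :=
    fun _ => rfl
  simp only [h, sub_mul]
  rw [intervalIntegral.integral_sub ((contDiff_mul_exp f z).continuous.intervalIntegrable _ _)
    ((contDiff_mul_exp g z).continuous.intervalIntegrable _ _)]
  ring

/-- Cauchy–Schwarz against the exponential truncated to `Iic x`, whose norm is at most that of the
full one. -/
theorem norm_integral_mul_exp_le (z : ℂ) (f : smoothFunctions) {x : ℝ}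
    (hx : x ∈ Icc (-L / 2) (L / 2)) :
    ‖∫ y in (-L / 2)..x, (f : ℝ → ℂ) y * Complex.exp (-Complex.I * z * y)‖ ≤
      ‖toL2 L (expFun (conj z))‖ * ‖toL2 L f‖ := by
  have hm := (memLp_smooth L (expFun (conj z))).indicator (measurableSet_Iic (a := x))
  have hu : ‖hm.toLp _‖ ≤ ‖toL2 L (expFun (conj z))‖ := by
    refine Lp.norm_le_norm_of_ae_le ?_
    filter_upwards [hm.coeFn_toLp, (memLp_smooth L (expFun (conj z))).coeFn_toLp] with y h1 h2
    change _ ≤ ‖(memLp_smooth L (expFun (conj z))).toLp _ y‖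
    rw [h1, h2]
    exact norm_indicator_le_norm_self _ _
  have hin : ∫ y in (-L / 2)..x, (f : ℝ → ℂ) y * Complex.exp (-Complex.I * z * y) =
      ⟪hm.toLp _, toL2 L f⟫_ℂ := by
    have hset : Icc (-L / 2) x = Icc (-L / 2) (L / 2) ∩ Iic x := by
      ext y
      simp only [mem_Icc, mem_inter_iff, mem_Iic]
      exact ⟨fun h => ⟨⟨h.1, h.2.trans hx.2⟩, h.2⟩, fun h => ⟨h.1.1, h.2⟩⟩
    rw [intervalIntegral.integral_of_le hx.1, ← integral_Icc_eq_integral_Ioc, hset, inter_comm,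
      ← Measure.restrict_restrict measurableSet_Iic, ← integral_indicator measurableSet_Iic,
      L2.inner_def]
    refine integral_congr_ae ?_
    filter_upwards [hm.coeFn_toLp, (memLp_smooth L f).coeFn_toLp] with y h1 h2
    change _ = ⟪hm.toLp _ y, (memLp_smooth L f).toLp _ y⟫_ℂ
    rw [h1, h2, RCLike.inner_apply]
    by_cases hy : y ∈ Iic x
    · rw [indicator_of_mem hy, indicator_of_mem hy, conj_expFun_conj]
    · rw [indicator_of_notMem hy, indicator_of_notMem hy, map_zero, mul_zero]
  rw [hin]
  exact (norm_inner_le_norm _ _).trans (by gcongr)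

theorem norm_resolventFun_le (z : ℂ) (f : smoothFunctions) :
    ‖toL2 L (resolventFun L z f)‖ ≤
      ‖toL2 L (expFun (conj z))‖ * ‖toL2 L (expFun z)‖ * ‖toL2 L f‖ := by
  have h : ‖toL2 L (resolventFun L z f)‖ ≤
      (‖toL2 L (expFun (conj z))‖ * ‖toL2 L f‖) * ‖toL2 L (expFun z)‖ := by
    refine Lp.norm_le_mul_norm_of_ae_le_mul ?_
    filter_upwards [(memLp_smooth L (resolventFun L z f)).coeFn_toLp,
      (memLp_smooth L (expFun z)).coeFn_toLp, ae_restrict_mem measurableSet_Icc] with x h1 h2 hx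
    change ‖(memLp_smooth L (resolventFun L z f)).toLp _ x‖ ≤
      _ * ‖(memLp_smooth L (expFun z)).toLp _ x‖
    rw [h1, h2, resolventFun_apply, ← expFun_apply, norm_mul, norm_mul, Complex.norm_I, one_mul,
      mul_comm]
    gcongr
    exact norm_integral_mul_exp_le z f hx
  linarith

/-- Integrate `-i u' - z u = f` against `exp(-i w x)` by parts; `u` vanishes at both endpoints. -/
theorem fourier_resolventFun (hL : 0 < L) {z : ℂ} {f : smoothFunctions}
    (h : fourier (toL2 L f) z = 0) (w : ℂ) :
    (w - z) * fourier (toL2 L (resolventFun L z f)) w = fourier (toL2 L f) w := by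
  set u := resolventFun L z f
  have hder : ∀ x : ℝ, HasDerivAt (fun x : ℝ => -Complex.I * ((u : ℝ → ℂ) x *
      Complex.exp (-Complex.I * w * x))) ((f : ℝ → ℂ) x * Complex.exp (-Complex.I * w * x) -
        (w - z) * ((u : ℝ → ℂ) x * Complex.exp (-Complex.I * w * x))) x := fun x => by
    have h2 : HasDerivAt (fun x : ℝ => -Complex.I * w * x) (-Complex.I * w) x := by
      simpa using (Complex.ofRealCLM.hasDerivAt (x := x)).const_mul (-Complex.I * w)
    refine (((hasDerivAt_resolventFun (L := L) z f x).mul h2.cexp).const_mul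
      (-Complex.I)).congr_deriv ?_
    change -Complex.I * (Complex.I * ((f : ℝ → ℂ) x + z * (u : ℝ → ℂ) x) * _ +
      (u : ℝ → ℂ) x * _) = _
    linear_combination (-((f : ℝ → ℂ) x + z * (u : ℝ → ℂ) x) + w * (u : ℝ → ℂ) x) *
      Complex.exp (-Complex.I * w * x) * Complex.I_mul_I
  have hc₁ := (contDiff_mul_exp f w).continuous
  have hc₂ := (contDiff_mul_exp u w).continuous
  have key := intervalIntegral.integral_eq_sub_of_hasDerivAt
    (a := -L / 2) (b := L / 2) (fun x _ => hder x)
    ((hc₁.sub (continuous_const.mul hc₂)).intervalIntegrable _ _)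
  rw [resolventFun_left, resolventFun_right hL h, intervalIntegral.integral_sub
    (hc₁.intervalIntegrable _ _) ((hc₂.intervalIntegrable _ _).const_mul (w - z)),
    intervalIntegral.integral_const_mul, ← fourier_toL2 hL, ← fourier_toL2 hL] at key
  simp only [zero_mul, mul_zero, sub_zero] at key
  linear_combination -key

end Primitive

/-! ### Zeros of the Fourier transform of the ground state -/

section Zeros

variable {L : ℝ}

/-- A bump function times `exp(i z x)` has as transform at `z` the integral of the bump. -/
theorem exists_fourier_ne_zero_compactlySupported (hL : 0 < L) (z : ℂ) :
    ∃ f ∈ compactlySupported L, fourier (toL2 L f) z ≠ 0 := by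
  let b : ContDiffBump (0 : ℝ) := ⟨L / 8, L / 4, by linarith, by linarith⟩
  have hb : ContDiff ℝ ∞ fun x : ℝ => (b x : ℂ) := Complex.ofRealCLM.contDiff.comp b.contDiff
  have hs : ContDiff ℝ ∞ fun x : ℝ => (b x : ℂ) * (expFun z : ℝ → ℂ) x := hb.mul (expFun z).2
  refine ⟨⟨_, hs⟩, ?_, ?_⟩
  · change tsupport (fun x : ℝ => (b x : ℂ) * (expFun z : ℝ → ℂ) x) ⊆ _
    have h1 : Function.support (fun x : ℝ => (b x : ℂ) * (expFun z : ℝ → ℂ) x) ⊆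
        Metric.ball 0 (L / 4) := fun x hx => by
      rw [← b.support_eq]
      intro h0
      exact hx (by simp [h0])
    refine (closure_mono h1).trans (Metric.closure_ball_subset_closedBall.trans ?_)
    rw [Real.closedBall_eq_Icc]
    exact Icc_subset_Ioo (by linarith) (by linarith)
  · rw [fourier_toL2 hL]
    have h2 : ∀ x : ℝ, (b x : ℂ) * (expFun z : ℝ → ℂ) x * Complex.exp (-Complex.I * z * x) =
        (b x : ℂ) := fun x => by
      rw [expFun_apply, mul_assoc, ← Complex.exp_add]
      simp
    change ∫ x in (-L / 2)..(L / 2), (b x : ℂ) * (expFun z : ℝ → ℂ) x *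
      Complex.exp (-Complex.I * z * x) ≠ 0
    simp only [h2]
    rw [intervalIntegral.integral_ofReal]
    refine Complex.ofReal_ne_zero.2 (ne_of_gt ?_)
    refine intervalIntegral.integral_pos (by linarith) b.continuous.continuousOn
      (fun x _ => b.nonneg) ⟨0, ⟨by linarith, by linarith⟩, ?_⟩
    exact b.pos_of_mem_ball (Metric.mem_ball_self b.rOut_pos)

/-- For the constant `1`, the transform is proportional to a difference of exponentials of moduli
`exp(± Im z L/2)`. At real `z` it can vanish. -/
theorem fourier_expFun_zero_ne_zero (hL : 0 < L) {z : ℂ} (hz : z.im ≠ 0) :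
    fourier (toL2 L (expFun 0)) z ≠ 0 := by
  have hz0 : -Complex.I * z ≠ 0 :=
    mul_ne_zero (neg_ne_zero.2 Complex.I_ne_zero) fun h => hz (by simp [h])
  rw [fourier_toL2 hL]
  simp only [expFun_apply, mul_zero, zero_mul, Complex.exp_zero, one_mul]
  rw [integral_exp_mul_complex hz0]
  refine div_ne_zero (fun h => ?_) hz0
  have h1 := congrArg norm (sub_eq_zero.1 h)
  rw [Complex.norm_exp, Complex.norm_exp, Real.exp_eq_exp] at h1
  simp only [Complex.mul_re, Complex.neg_re, Complex.I_re, neg_zero, zero_mul, Complex.neg_im,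
    Complex.I_im, Complex.ofReal_re, Complex.ofReal_im, mul_zero, sub_zero] at h1
  have h2 : z.im * L = 0 := by linarith
  exact (mul_ne_zero hz hL.ne') h2

theorem exists_fourier_eq_one (hL : 0 < L) {V : Submodule ℂ smoothFunctions}
    (hV : V = compactlySupported L ∨ V = smoothPeriodic L ∨ V = ⊤) {z : ℂ} (hz : z.im ≠ 0) :
    ∃ f ∈ V, fourier (toL2 L f) z = 1 := by
  obtain ⟨f, hf, hne⟩ : ∃ f ∈ V, fourier (toL2 L f) z ≠ 0 := by
    rcases hV with rfl | rfl | rfl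
    · exact exists_fourier_ne_zero_compactlySupported hL z
    · refine ⟨expFun 0, fun x => ?_, fourier_expFun_zero_ne_zero hL hz⟩
      simp [expFun_apply]
    · exact ⟨expFun 0, trivial, fourier_expFun_zero_ne_zero hL hz⟩
  refine ⟨(fourier (toL2 L f) z)⁻¹ • f, V.smul_mem _ hf, ?_⟩
  rw [fourier_eq_inner, map_smul, inner_smul_right, ← fourier_eq_inner, inv_mul_cancel₀ hne]

theorem resolventFun_mem (hL : 0 < L) {V : Submodule ℂ smoothFunctions}
    (hV : V = compactlySupported L ∨ V = smoothPeriodic L ∨ V = ⊤) {z : ℂ} {f : smoothFunctions}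
    (hf : f ∈ V) (h : fourier (toL2 L f) z = 0) : resolventFun L z f ∈ V := by
  rcases hV with rfl | rfl | rfl
  · exact resolventFun_mem_compactlySupported hL hf h
  · exact resolventFun_mem_smoothPeriodic hL hf h
  · trivial

theorem DefinesOperator.mem_graph_iff_subtype {D : RealDistribution L}
    {V : Submodule ℂ smoothFunctions} {A : L2 L →ₗ.[ℂ] L2 L}
    (hA : DefinesOperator V (kernelForm D) A) (u w : L2 L) :
    (u, w) ∈ A.graph ↔ ∃ f : ℕ → V,
      Tendsto (fun n => (toL2 L).domRestrict V (f n)) atTop (𝓝 u) ∧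
      Tendsto (fun p : ℕ × ℕ => kernelSesq D V (f p.1 - f p.2) (f p.1 - f p.2)) atTop (𝓝 0) ∧
      ∀ v, Tendsto (fun n => kernelSesq D V v (f n)) atTop
        (𝓝 ⟪(toL2 L).domRestrict V v, w⟫_ℂ) := by
  rw [hA.mem_graph_iff]
  constructor
  · rintro ⟨f, hf, h1, h2, h3⟩
    exact ⟨fun n => ⟨f n, hf n⟩, h1, h2, fun v => h3 v v.2⟩
  · rintro ⟨f, h1, h2, h3⟩
    exact ⟨fun n => f n, fun n => (f n).2, h1, h2, fun v hv => h3 ⟨v, hv⟩⟩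

theorem DefinesOperator.form_ge {D : RealDistribution L}
    {V : Submodule ℂ smoothFunctions} {A : L2 L →ₗ.[ℂ] L2 L}
    (hA : DefinesOperator V (kernelForm D) A) {l : ℝ} (hl : ∀ x ∈ spectrum A, l ≤ x.re) (f : V) :
    l * ‖(toL2 L).domRestrict V f‖ ^ 2 ≤ (kernelSesq D V f f).re := by
  obtain ⟨c, hc⟩ := hA.lowerBounded
  have hQ : ∀ f g : V, conj (kernelSesq D V f g) = kernelSesq D V g f := fun f g =>
    conj_kernelForm D f g
  have hc' : ∀ f : V, c * ‖(toL2 L).domRestrict V f‖ ^ 2 ≤ (kernelSesq D V f f).re :=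
    fun f => hc f f.2
  have h1 := form_ge_of_spectrum (H := L2 L) (E := V) (c := c) ((toL2 L).domRestrict V)
    (kernelSesq D V) hQ
  have h2 := h1 hc'
  have h3 := h2 A
  have hg : ∀ (u w : L2 L) (f : ℕ → V),
      Tendsto (fun n => (toL2 L).domRestrict V (f n)) atTop (𝓝 u) →
      Tendsto (fun p : ℕ × ℕ => kernelSesq D V (f p.1 - f p.2) (f p.1 - f p.2)) atTop (𝓝 0) →
      (∀ v, Tendsto (fun n => kernelSesq D V v (f n)) atTop
        (𝓝 ⟪(toL2 L).domRestrict V v, w⟫_ℂ)) → (u, w) ∈ A.graph :=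
    fun u w f hu hd hv => (hA.mem_graph_iff_subtype u w).2 ⟨f, hu, hd, hv⟩
  have h4 := h3 hg (l := l)
  exact h4 hl f

open Classical in
theorem im_eq_zero_of_fourier_eq_zero (hL : 0 < L) (D : RealDistribution L)
    {V : Submodule ℂ smoothFunctions}
    (hV : V = compactlySupported L ∨ V = smoothPeriodic L ∨ V = ⊤) {A : L2 L →ₗ.[ℂ] L2 L}
    (hA : DefinesOperator V (kernelForm D) A) {l : ℝ} {η : L2 L}
    (hη : IsSimpleIsolatedBottom A l η) {z : ℂ} (hz : fourier η z = 0) : z.im = 0 := by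
  by_contra him
  set j : V →ₗ[ℂ] L2 L := (toL2 L).domRestrict V
  have hQ : ∀ f g : V, conj (kernelSesq D V f g) = kernelSesq D V g f := fun f g =>
    conj_kernelForm D f g
  have hl := hA.form_ge hη.le_of_mem
  have hgr : (η, (l : ℂ) • η) ∈ A.graph := by
    obtain ⟨h, h'⟩ := hη.eigenvector
    rw [← h']
    exact A.mem_graph ⟨η, h⟩
  obtain ⟨χ, hχV, hχ⟩ := exists_fourier_eq_one hL hV him
  have hF : ∀ f : V, ⟪toL2 L (expFun (conj z)), j f⟫_ℂ = 0 → fourier (toL2 L f) z = 0 :=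
    fun f hf => by rwa [fourier_eq_inner]
  obtain ⟨S, hS⟩ : ∃ S : V → V, ∀ f : V, ⟪toL2 L (expFun (conj z)), j f⟫_ℂ = 0 →
      ((S f : V) : smoothFunctions) = resolventFun L z f := by
    refine ⟨fun f => if h : fourier (toL2 L f) z = 0 then
      ⟨resolventFun L z f, resolventFun_mem hL hV f.2 h⟩ else 0, fun f hf => ?_⟩
    simp only
    rw [dif_pos (hF f hf)]
  have hSC : ∀ f g : V, ⟪toL2 L (expFun (conj z)), j f⟫_ℂ = 0 →
      ⟪toL2 L (expFun (conj z)), j g⟫_ℂ = 0 → ‖j (S f) - j (S g)‖ ≤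
        ‖toL2 L (expFun (conj z))‖ * ‖toL2 L (expFun z)‖ * ‖j f - j g‖ := fun f g hf hg => by
    change ‖toL2 L (S f : V) - toL2 L (S g : V)‖ ≤ _ * ‖toL2 L f - toL2 L g‖
    rw [hS f hf, hS g hg, ← map_sub, ← map_sub, resolventFun_sub]
    exact norm_resolventFun_le z _
  have hSQ : ∀ g : V, ⟪toL2 L (expFun (conj z)), j g⟫_ℂ = 0 →
      (kernelSesq D V (S g) (g + z • S g)).im = 0 := fun g hg => by
    change (kernelForm D (S g : V) ((g : smoothFunctions) + z • (S g : V))).im = 0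
    rw [hS g hg]
    exact im_kernelForm_neg_I_deriv D _ _ (hasDerivAt_resolventFun z g)
      (resolventFun_left z g) (resolventFun_right hL (hF g hg))
  have hSj : ∀ g : V, ⟪toL2 L (expFun (conj z)), j g⟫_ℂ = 0 →
      (⟪j (S g), j (g + z • S g)⟫_ℂ).im = 0 := fun g hg => by
    change (⟪toL2 L (S g : V), toL2 L ((g : smoothFunctions) + z • (S g : V))⟫_ℂ).im = 0
    rw [hS g hg]
    exact im_inner_neg_I_deriv _ _ (hasDerivAt_resolventFun z g)
      (resolventFun_left z g) (resolventFun_right hL (hF g hg))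
  have hχ' : ⟪toL2 L (expFun (conj z)), j ⟨χ, hχV⟩⟫_ℂ = 1 := by
    rw [← hχ, fourier_eq_inner]
    rfl
  rw [fourier_eq_inner] at hz
  have h1 := exists_tendsto_mem_graph (H := L2 L) (E := V) (l := l) j (kernelSesq D V) hQ
  have h2 := h1 hl
  have h3 := h2 A
  have h4 := h3 hA.mem_graph_iff_subtype (η := η)
  obtain ⟨g, ξ, hg0, hg, hξ, hξA⟩ := h4 hgr hχ' hz him S _ hSC hSQ hSj
  obtain ⟨a, ha⟩ : ∃ a : ℂ, ξ = a • η := by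
    obtain ⟨y, hy1, hy2⟩ := (LinearPMap.mem_graph_iff A).1 hξA
    obtain ⟨a, ha⟩ := hη.simple y (by rw [hy2, hy1])
    exact ⟨a, by rw [← ha, hy1]⟩
  have hfη : ∀ w, (w - z) * fourier ξ w = fourier η w := fun w => by
    have h1 : Tendsto (fun n => (w - z) * fourier (j (S (g n))) w) atTop
        (𝓝 ((w - z) * fourier ξ w)) := by
      simp only [fourier_eq_inner]
      exact (tendsto_const_nhds.inner hξ).const_mul _
    have h2 : Tendsto (fun n => fourier (j (g n)) w) atTop (𝓝 (fourier η w)) := by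
      simp only [fourier_eq_inner]
      exact tendsto_const_nhds.inner hg
    refine tendsto_nhds_unique h1 (h2.congr fun n => ?_)
    change fourier (toL2 L (g n)) w = (w - z) * fourier (toL2 L (S (g n) : V)) w
    rw [hS _ (hg0 n), fourier_resolventFun hL (hF _ (hg0 n))]
  -- `(w - z) a = 1` can hold only at `w = z + a⁻¹`. If `a = 0` it never holds, and the junk value
  -- `a⁻¹ = 0` is harmless.
  refine hη.ne_zero (eq_zero_of_fourier_eq_zero η (w₀ := z + a⁻¹) fun w hw => ?_)
  have h1 := hfη w
  rw [ha, fourier_eq_inner, inner_smul_right, ← fourier_eq_inner] at h1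
  by_contra hne
  have h2 : (w - z) * a = 1 := mul_right_cancel₀ hne (by linear_combination h1)
  exact hw (by linear_combination eq_inv_of_mul_eq_one_left h2)

end Zeros

end RealZeros

theorem theorem1 (L : ℝ) (hL : 0 < L) (D : RealZeros.RealDistribution L)
    (V : Submodule ℂ RealZeros.smoothFunctions)
    (hV : V = RealZeros.compactlySupported L ∨ V = RealZeros.smoothPeriodic L ∨ V = ⊤)
    (A : RealZeros.L2 L →ₗ.[ℂ] RealZeros.L2 L)
    (hAself : IsSelfAdjoint A)
    (hA : RealZeros.DefinesOperator V (RealZeros.kernelForm D) A)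
    (l : ℝ) (η : RealZeros.L2 L)
    (hη : RealZeros.IsSimpleIsolatedBottom A l η)
    (heven : ∀ᵐ x ∂(RealZeros.intervalMeasure L), η (-x) = η x) :
    Differentiable ℂ (RealZeros.fourier η) ∧
      ∀ z : ℂ, RealZeros.fourier η z = 0 → z.im = 0 :=
  ⟨RealZeros.differentiable_fourier η, fun _ =>
    RealZeros.im_eq_zero_of_fourier_eq_zero hL D hV hA hη⟩
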